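/- Let $R$ be a unique factorization domain with group of units $R^*$ and field of fractions $K$, and fix a set $\mathcal U\subset R\setminus\{0\}$ containing exactly one associate of every nonzero element of $R$. Let $\mathrm{GA}_2(R)$ be the group of $R$-algebra automorphisms of $R[x,y]$ (the product is composition), and let $\mathcal B^1(R)=\{px+Q(y)\;:\;p\in R\setminus\{0\},\ Q\in R[y]\}$. For a commutative ring $A$, let $\mathrm{VA}_1(A)$ be the set of images of $y$ under the $A$-algebra automorphisms of $A[y]$. An automorphism of $R[x,y]$ is tame if it lies in the subgroup of $\mathrm{GA}_2(R)$ generated by the affine automorphisms (those $\sigma$ for which $\sigma(x)$ and $\sigma(y)$ have degree $1$) and the triangular ones (those $\sigma$ with $\sigma(x)\in R^*x+R[y]$ and $\sigma(y)\in R^*y+R$). Let $(p_1,p_2,Q_1,Q_2)$ be a reduced quadruplet, that is: $p_1\in\mathcal U$, $p_2\in K\setminus\{0\}$, $Q_1\in R[y]$, $Q_2\in K[y]$, $\deg Q_1\ge 1$, $\deg Q_2\ge 2$, $Q_1(0)=Q_2(0)=0$, $\gcd(p_1,Q_1)=1$ in $R[y]$, and $$F=p_2y+Q_2(p_1x+Q_1(y))\in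 R[x,y].$$ Assume that $F$ is a coordinate, i.e. $F=\sigma(y)$ for some $\sigma\in\mathrm{GA}_2(R)$. We say that $F$ is tame if $F=\sigma(y)$ for some tame automorphism $\sigma$; that $F$ has a mate of length $1$ if there are $G\in\mathcal B^1(R)$ and $\sigma\in\mathrm{GA}_2(R)$ with $\sigma(x)=F$ and $\sigma(y)=G$; and that $F$ has length "$1+1$" if there are $\sigma,\tau\in\mathrm{GA}_2(R)$ with $\sigma(y),\tau(y)\in\mathcal B^1(R)$ and $\sigma\tau(y)=F$. Then: 1. $F$ is tame if and only if there are $\sigma,\tau\in\mathrm{GA}_2(R)$ such that $\sigma(x),\sigma(y),\tau(x),\tau(y)\in\mathcal B^1(R)$ and $\sigma\tau(y)=F$. 2. $F$ has a mate of length $1$ if and only if $p_1p_2\in R^*$. 3. $F$ has length "$1+1$" if and only if the reduction of $Q_1$ modulo $p_1$ lies in $\mathrm{VA}_1(R/p_1R)$. 4. If $F$ is tame or $F$ has a mate of length $1$, then $F$ has length "$1+1$". -/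

import Mathlib

open Polynomial

noncomputable section

namespace LengthTwo

/-- `GA_n(R)`: the group of automorphisms of the `R`-algebra `R[x_1, …, x_n]`. The product is
composition, `(σ * τ) f = σ (τ f)`. For `n = 2` we write `x = X 0` and `y = X 1`. -/
abbrev GA (n : ℕ) (R : Type*) [CommRing R] : Type _ :=
  MvPolynomial (Fin n) R ≃ₐ[R] MvPolynomial (Fin n) R

/-- `VA_1(R)`: the coordinates of `R[y]`. -/
def VA₁ (R : Type*) [CommRing R] : Set R[X] :=
  {P | ∃ σ : R[X] ≃ₐ[R] R[X], σ X = P}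

/-- `VA_2(R)`: the coordinates of `R[x, y]`. -/
def VA₂ (R : Type*) [CommRing R] : Set (MvPolynomial (Fin 2) R) :=
  {F | ∃ σ : GA 2 R, σ (MvPolynomial.X 1) = F}

/-- Affine automorphisms: every component has total degree `1`. -/
def Aff (n : ℕ) (R : Type*) [CommRing R] : Set (GA n R) :=
  {σ | ∀ i, (σ (MvPolynomial.X i)).totalDegree = 1}

/-- Triangular automorphisms: `σ(x_i) ∈ R^* x_i + R[x_{i+1}, …, x_n]` for every `i`. -/
def BA (n : ℕ) (R : Type*) [CommRing R] : Set (GA n R) :=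
  {σ | ∀ i, ∃ u : Rˣ, ∃ g ∈ MvPolynomial.supported R {j : Fin n | i < j},
    σ (MvPolynomial.X i) = MvPolynomial.C (u : R) * MvPolynomial.X i + g}

/-- The tame automorphism group, generated by affine and triangular automorphisms. -/
def TA (n : ℕ) (R : Type*) [CommRing R] : Subgroup (GA n R) :=
  Subgroup.closure (Aff n R ∪ BA n R)

/-- `B^1(R)`: the polynomials `p x + Q(y)` with `p` a non zero-divisor of `R` and `Q ∈ R[y]`. -/
def B1 (R : Type*) [CommRing R] : Set (MvPolynomial (Fin 2) R) :=
  {F | ∃ p ∈ nonZeroDivisors R, ∃ Q : R[X],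
    F = MvPolynomial.C p * MvPolynomial.X 0 + aeval (MvPolynomial.X 1) Q}

/-- The polynomial `p₂ y + Q₂(p₁ x + Q₁(y))`. -/
def length2Poly {K : Type*} [CommRing K] (p₁ p₂ : K) (Q₁ Q₂ : K[X]) : MvPolynomial (Fin 2) K :=
  MvPolynomial.C p₂ * MvPolynomial.X 1 +
    aeval (MvPolynomial.C p₁ * MvPolynomial.X 0 + aeval (MvPolynomial.X 1) Q₁) Q₂

/-- `U` is a system of representatives of the non zero-divisors of `R` up to units. -/
structure IsUnitRepresentatives {R : Type*} [CommRing R] (U : Set R) : Prop where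
  subset : U ⊆ (nonZeroDivisors R : Set R)
  existsUnique : ∀ r ∈ nonZeroDivisors R, ∃! w, w ∈ U ∧ Associated r w

/-- The set `L_2(R)` of quadruplets over the field of fractions `K` of `R`. -/
structure IsL2 (R : Type*) {K : Type*} [CommRing R] [Field K] [Algebra R K]
    (p₁ p₂ : K) (Q₁ Q₂ : K[X]) : Prop where
  p₁_ne_zero : p₁ ≠ 0
  p₂_ne_zero : p₂ ≠ 0
  one_le_degree : 1 ≤ Q₁.natDegree
  two_le_degree : 2 ≤ Q₂.natDegree
  integral : ∃ F : MvPolynomial (Fin 2) R,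
    MvPolynomial.map (algebraMap R K) F = length2Poly p₁ p₂ Q₁ Q₂

/-- Reduced quadruplets of `L_2(R)`. As a reduced quadruplet has `p₁ ∈ U ⊆ R` and `Q₁ ∈ R[y]`,
these two entries are given in `R` and `R[y]`. -/
structure IsReducedL2 {R K : Type*} [CommRing R] [Field K] [Algebra R K] (U : Set R)
    (p₁ : R) (p₂ : K) (Q₁ : R[X]) (Q₂ : K[X]) : Prop where
  isL2 : IsL2 R (algebraMap R K p₁) p₂ (Q₁.map (algebraMap R K)) Q₂
  Q₁_zero : Q₁.eval 0 = 0
  Q₂_zero : Q₂.eval 0 = 0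
  p₁_mem : p₁ ∈ U
  gcd_eq_one : IsRelPrime (C p₁) Q₁

/-- `F` is tame: `F = σ(y)` for a tame automorphism `σ` of `R[x, y]`. -/
def IsTame {R : Type*} [CommRing R] (F : MvPolynomial (Fin 2) R) : Prop :=
  ∃ σ ∈ TA 2 R, σ (MvPolynomial.X 1) = F

/-- `F` has a mate of length 1: `(F, G) ∈ GA_2(R)` for some `G ∈ B^1(R)`. -/
def HasMateOfLengthOne {R : Type*} [CommRing R] (F : MvPolynomial (Fin 2) R) : Prop :=
  ∃ G ∈ B1 R, ∃ σ : GA 2 R, σ (MvPolynomial.X 0) = F ∧ σ (MvPolynomial.X 1) = G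

/-- `F` has length "1+1". -/
def HasLengthOnePlusOne {R : Type*} [CommRing R] (F : MvPolynomial (Fin 2) R) : Prop :=
  ∃ σ τ : GA 2 R, σ (MvPolynomial.X 1) ∈ B1 R ∧ τ (MvPolynomial.X 1) ∈ B1 R ∧
    (σ * τ) (MvPolynomial.X 1) = F

end LengthTwo

end

open LengthTwo

/-! Put f = p₁x + Q₁(y). Over K the pair (f, F) is an automorphism with Jacobian p₁p₂. Two
automorphisms with the same second component differ by a triangular one (`exists_eq_mul_tri`), so
every mate of F over K has the form c f + k(F) with c a nonzero constant. For a mate that is short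
or of small degree, a degree comparison makes k constant. As gcd(p₁, Q₁) = 1 and Q₁(0) = 0, a
coordinate over R that is K-affine in f is then R-affine in f (`coordinate_eq_of_map`), so f is
itself a coordinate.

Statement 2: a mate of length 1 can be replaced by f, and the Jacobian of (f, F) must be a unit of
R; conversely, a unit Jacobian makes f a mate. Statement 3: if F has length "1+1", the intermediate
coordinate is K-affine in f, so f is a coordinate. Reducing modulo p₁ then makes Q₁ a coordinate
(`mem_VA₁_of_GA`). Conversely, an inverse P of Q₁ modulo p₁ gives the mate (y - P(f))/p₁ of f, in
terms of which F has length 1. Statement 1: tame automorphisms have a normal form with increasing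
degrees, so a tame F has a tame mate of smaller degree, necessarily affine in f. The same argument
applied to f, whose K-mate of smaller degree is y, splits F into two pairs of length-one
polynomials. Such pairs are always tame (`mem_TA_of_mem_B1`). Statement 4: the factors found for 1
already have length "1+1", and a mate of length 1 makes f a coordinate, so 3 applies. -/

noncomputable section

namespace LengthTwo

local notation "𝐱" => MvPolynomial.X (0 : Fin 2)
local notation "𝐲" => MvPolynomial.X (1 : Fin 2)

/-! ### Length-one polynomials, substitutions, base change, Jacobians. -/

section Basic

variable {R S : Type*} [CommRing R] [CommRing S]

/-- The polynomial `p x + Q(y)`. -/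
def lenOne (p : R) (Q : R[X]) : MvPolynomial (Fin 2) R :=
  MvPolynomial.C p * 𝐱 + aeval 𝐲 Q

lemma apply_lenOne {A G : Type*} [CommRing A] [Algebra R A]
    [FunLike G (MvPolynomial (Fin 2) R) A] [AlgHomClass G R (MvPolynomial (Fin 2) R) A]
    (φ : G) (p : R) (Q : R[X]) :
    φ (lenOne p Q) = algebraMap R A p * φ 𝐱 + aeval (φ 𝐲) Q := by
  rw [lenOne, map_add, map_mul, Polynomial.aeval_algHom_apply, ← MvPolynomial.algebraMap_eq,
    AlgHomClass.commutes]

lemma apply_C {A G : Type*} [CommRing A] [Algebra R A]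
    [FunLike G (MvPolynomial (Fin 2) R) A] [AlgHomClass G R (MvPolynomial (Fin 2) R) A]
    (φ : G) (r : R) : φ (MvPolynomial.C r) = algebraMap R A r := by
  rw [← MvPolynomial.algebraMap_eq, AlgHomClass.commutes]

@[simp]
lemma GA_apply_C (σ : GA 2 R) (r : R) : σ (MvPolynomial.C r) = MvPolynomial.C r :=
  apply_C σ r

lemma map_aeval_eq (φ : R →+* S) (P : MvPolynomial (Fin 2) R) (Q : R[X]) :
    MvPolynomial.map φ (aeval P Q) = aeval (MvPolynomial.map φ P) (Q.map φ) := by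
  induction Q using Polynomial.induction_on' with
  | add a b ha hb => simp [ha, hb]
  | monomial n a =>
    simp [Polynomial.aeval_monomial, MvPolynomial.algebraMap_eq, Polynomial.map_monomial]

lemma map_lenOne (φ : R →+* S) (p : R) (Q : R[X]) :
    MvPolynomial.map φ (lenOne p Q) = lenOne (φ p) (Q.map φ) := by
  simp [lenOne, map_aeval_eq]

/-- Substitution of two univariate polynomials for `x` and `y`. -/
def subst (a b : R[X]) : MvPolynomial (Fin 2) R →ₐ[R] R[X] :=
  MvPolynomial.aeval ![a, b]

@[simp] lemma subst_x (a b : R[X]) : subst a b 𝐱 = a := by simp [subst]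
@[simp] lemma subst_y (a b : R[X]) : subst a b 𝐲 = b := by simp [subst]
@[simp] lemma subst_C (a b : R[X]) (r : R) : subst a b (MvPolynomial.C r) = C r := by
  simp [subst]

lemma subst_aeval (a b : R[X]) (P : MvPolynomial (Fin 2) R) (Q : R[X]) :
    subst a b (aeval P Q) = Q.comp (subst a b P) := by
  rw [← Polynomial.aeval_algHom_apply, Polynomial.comp_eq_aeval]

@[simp] lemma subst_lenOne (a b : R[X]) (p : R) (Q : R[X]) :
    subst a b (lenOne p Q) = C p * a + Q.comp b := by
  rw [lenOne, map_add, map_mul, subst_aeval]; simp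

lemma subst_map (φ : R →+* S) (a b : R[X]) (P : MvPolynomial (Fin 2) R) :
    subst (a.map φ) (b.map φ) (MvPolynomial.map φ P) = (subst a b P).map φ := by
  induction P using MvPolynomial.induction_on with
  | C r => simp
  | add p q hp hq => simp [hp, hq]
  | mul_X p i hp => fin_cases i <;> simp [hp]

lemma lenOne_inj {p p' : R} {Q Q' : R[X]} (h : lenOne p Q = lenOne p' Q') : p = p' ∧ Q = Q' := by
  have h1 : Q = Q' := by simpa using congrArg (subst 0 X) h
  refine ⟨?_, h1⟩
  have h2 := congrArg (subst X 0) h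
  simp only [subst_lenOne, h1, add_left_inj] at h2
  simpa using congrArg (fun P => P.coeff 1) h2

/-- A polynomial over `R` that becomes `p x + Q(y)` after an injective change of coefficients is
itself of that form. -/
lemma exists_lenOne_of_map {φ : R →+* S} (hφ : Function.Injective φ) {G : MvPolynomial (Fin 2) R}
    {p : S} {Q : S[X]} (h : MvPolynomial.map φ G = lenOne p Q) :
    ∃ p' Q', G = lenOne p' Q' ∧ φ p' = p ∧ Q'.map φ = Q := by
  have hQ : (subst 0 X G).map φ = Q := by
    rw [← subst_map, h]; simp
  have hp : φ ((subst X 0 G).coeff 1) = p := by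
    rw [← Polynomial.coeff_map, ← subst_map, h]; simp
  refine ⟨_, _, ?_, hp, hQ⟩
  apply MvPolynomial.map_injective φ hφ
  rw [map_lenOne, hp, hQ, h]

lemma GA_ext {σ τ : GA 2 R} (h0 : σ 𝐱 = τ 𝐱) (h1 : σ 𝐲 = τ 𝐲) : σ = τ := by
  apply AlgEquiv.coe_toAlgHom_injective
  apply MvPolynomial.algHom_ext
  intro i
  fin_cases i
  · exact h0
  · exact h1

/-- An automorphism built from two mutually inverse substitutions. -/
def mkGA (v w : Fin 2 → MvPolynomial (Fin 2) R)
    (h : ∀ i, MvPolynomial.aeval v (w i) = MvPolynomial.X i)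
    (h' : ∀ i, MvPolynomial.aeval w (v i) = MvPolynomial.X i) : GA 2 R :=
  AlgEquiv.ofAlgHom (MvPolynomial.aeval v) (MvPolynomial.aeval w)
    (MvPolynomial.algHom_ext fun i => by
      rw [AlgHom.comp_apply, MvPolynomial.aeval_X, h, AlgHom.id_apply])
    (MvPolynomial.algHom_ext fun i => by
      rw [AlgHom.comp_apply, MvPolynomial.aeval_X, h', AlgHom.id_apply])

@[simp] lemma mkGA_X (v w : Fin 2 → MvPolynomial (Fin 2) R) (h h') (i : Fin 2) :
    mkGA v w h h' (MvPolynomial.X i) = v i := by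
  simp [mkGA]

lemma GA_apply (σ : GA 2 R) (P : MvPolynomial (Fin 2) R) :
    σ P = MvPolynomial.aeval (fun i => σ (MvPolynomial.X i)) P := by
  have := MvPolynomial.aeval_unique (σ : MvPolynomial (Fin 2) R →ₐ[R] MvPolynomial (Fin 2) R)
  exact DFunLike.congr_fun this P

lemma aeval_map_comp (φ : R →+* S) (v : Fin 2 → MvPolynomial (Fin 2) R)
    (P : MvPolynomial (Fin 2) R) :
    MvPolynomial.aeval (fun i => MvPolynomial.map φ (v i)) (MvPolynomial.map φ P) =
      MvPolynomial.map φ (MvPolynomial.aeval v P) := by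
  induction P using MvPolynomial.induction_on with
  | C r => simp [MvPolynomial.algebraMap_eq]
  | add p q hp hq => simp only [map_add, hp, hq]
  | mul_X p i hp => simp only [map_mul, hp, MvPolynomial.map_X, MvPolynomial.aeval_X]

/-- Change of coefficients for automorphisms. -/
def baseChange (φ : R →+* S) (σ : GA 2 R) : GA 2 S :=
  mkGA (fun i => MvPolynomial.map φ (σ (MvPolynomial.X i)))
    (fun i => MvPolynomial.map φ (σ⁻¹ (MvPolynomial.X i)))
    (fun i => by
      rw [aeval_map_comp, ← GA_apply, ← AlgEquiv.mul_apply]; simp)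
    (fun i => by
      rw [aeval_map_comp, ← GA_apply, ← AlgEquiv.mul_apply]; simp)

lemma baseChange_map (φ : R →+* S) (σ : GA 2 R) (P : MvPolynomial (Fin 2) R) :
    baseChange φ σ (MvPolynomial.map φ P) = MvPolynomial.map φ (σ P) := by
  rw [GA_apply, GA_apply σ, ← aeval_map_comp]
  simp [baseChange]

@[simp] lemma baseChange_X (φ : R →+* S) (σ : GA 2 R) (i : Fin 2) :
    baseChange φ σ (MvPolynomial.X i) = MvPolynomial.map φ (σ (MvPolynomial.X i)) := by
  simp [baseChange]

/-- The automorphism `x ↦ u x + h(y)`, `y ↦ y`. -/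
def tri (u : Rˣ) (h : R[X]) : GA 2 R :=
  mkGA ![lenOne (u : R) h, 𝐲] ![lenOne ((u⁻¹ : Rˣ) : R) (-(C ((u⁻¹ : Rˣ) : R) * h)), 𝐲]
    (fun i => by
      fin_cases i
      · simp [apply_lenOne, MvPolynomial.algebraMap_eq]
        simp [lenOne, mul_add, ← mul_assoc, ← map_mul]
      · simp)
    (fun i => by
      fin_cases i
      · simp [apply_lenOne, MvPolynomial.algebraMap_eq]
        have hu : MvPolynomial.C (σ := Fin 2) (u : R) * MvPolynomial.C ((u⁻¹ : Rˣ) : R) = 1 := by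
          rw [← map_mul]; simp
        rw [lenOne, map_neg, map_mul, aeval_C, MvPolynomial.algebraMap_eq]
        linear_combination (𝐱 - aeval 𝐲 h) * hu
      · simp)

@[simp] lemma tri_x (u : Rˣ) (h : R[X]) : tri u h 𝐱 = lenOne (u : R) h := by simp [tri]
@[simp] lemma tri_y (u : Rˣ) (h : R[X]) : tri u h 𝐲 = 𝐲 := by simp [tri]

/-- The automorphism exchanging `x` and `y`. -/
def swap : GA 2 R :=
  mkGA ![𝐲, 𝐱] ![𝐲, 𝐱] (fun i => by fin_cases i <;> simp) (fun i => by fin_cases i <;> simp)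

@[simp] lemma swap_x : (swap : GA 2 R) 𝐱 = 𝐲 := by simp [swap]
@[simp] lemma swap_y : (swap : GA 2 R) 𝐲 = 𝐱 := by simp [swap]

@[simp] lemma GA_inv_apply_self (σ : GA 2 R) (P : MvPolynomial (Fin 2) R) : σ⁻¹ (σ P) = P :=
  σ.symm_apply_apply P

@[simp] lemma GA_apply_inv_self (σ : GA 2 R) (P : MvPolynomial (Fin 2) R) : σ (σ⁻¹ P) = P :=
  σ.apply_symm_apply P

lemma GA_inv_apply_eq {σ : GA 2 R} {P Q : MvPolynomial (Fin 2) R} : σ⁻¹ P = Q ↔ P = σ Q :=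
  σ.symm_apply_eq

lemma GA_lenOne (σ : GA 2 R) (p : R) (Q : R[X]) :
    σ (lenOne p Q) = MvPolynomial.C p * σ 𝐱 + aeval (σ 𝐲) Q := apply_lenOne σ p Q

lemma GA_aeval (σ : GA 2 R) (P : MvPolynomial (Fin 2) R) (Q : R[X]) :
    σ (aeval P Q) = aeval (σ P) Q := (Polynomial.aeval_algHom_apply σ P Q).symm

/-- The Jacobian determinant of a pair of polynomials. -/
def jacobian (P Q : MvPolynomial (Fin 2) R) : MvPolynomial (Fin 2) R :=
  MvPolynomial.pderiv 0 P * MvPolynomial.pderiv 1 Q -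
    MvPolynomial.pderiv 1 P * MvPolynomial.pderiv 0 Q

lemma pderiv_GA (σ : GA 2 R) (i : Fin 2) (P : MvPolynomial (Fin 2) R) :
    MvPolynomial.pderiv i (σ P) =
      σ (MvPolynomial.pderiv 0 P) * MvPolynomial.pderiv i (σ 𝐱) +
      σ (MvPolynomial.pderiv 1 P) * MvPolynomial.pderiv i (σ 𝐲) := by
  induction P using MvPolynomial.induction_on with
  | C r => simp
  | add p q hp hq => simp [hp, hq]; ring
  | mul_X p j hp => fin_cases j <;> simp [hp] <;> ring

lemma jacobian_GA (σ : GA 2 R) (P Q : MvPolynomial (Fin 2) R) :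
    jacobian (σ P) (σ Q) = σ (jacobian P Q) * jacobian (σ 𝐱) (σ 𝐲) := by
  simp only [jacobian, pderiv_GA σ _ P, pderiv_GA σ _ Q, map_sub, map_mul]
  ring

lemma jacobian_map (φ : R →+* S) (P Q : MvPolynomial (Fin 2) R) :
    jacobian (MvPolynomial.map φ P) (MvPolynomial.map φ Q) =
      MvPolynomial.map φ (jacobian P Q) := by
  simp [jacobian, MvPolynomial.pderiv_map]

lemma jacobian_isUnit (σ : GA 2 R) : IsUnit (jacobian (σ 𝐱) (σ 𝐲)) := by
  -- Chain rule for σ ∘ σ⁻¹: the Jacobian of (x, y), which is 1, factors through that of σ.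
  have h := jacobian_GA σ (σ⁻¹ 𝐱) (σ⁻¹ 𝐲)
  rw [GA_apply_inv_self, GA_apply_inv_self] at h
  have h1 : jacobian (𝐱 : MvPolynomial (Fin 2) R) 𝐲 = 1 := by simp [jacobian]
  rw [h1] at h
  exact IsUnit.of_mul_eq_one _ (by rw [mul_comm]; exact h.symm)

lemma jacobian_eq_C [IsDomain R] (σ : GA 2 R) :
    ∃ u : Rˣ, jacobian (σ 𝐱) (σ 𝐲) = MvPolynomial.C (u : R) := by
  obtain ⟨r, hr, h⟩ := MvPolynomial.isUnit_iff_eq_C_of_isReduced.1 (jacobian_isUnit σ)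
  exact ⟨hr.unit, h⟩

lemma pderiv_aeval (i : Fin 2) (P : MvPolynomial (Fin 2) R) (Q : R[X]) :
    MvPolynomial.pderiv i (aeval P Q) = aeval P (derivative Q) * MvPolynomial.pderiv i P := by
  rw [Derivation.map_aeval, smul_eq_mul]

lemma pderiv_zero_lenOne (p : R) (Q : R[X]) :
    MvPolynomial.pderiv 0 (lenOne p Q) = MvPolynomial.C p := by
  simp [lenOne]

lemma pderiv_one_lenOne (p : R) (Q : R[X]) :
    MvPolynomial.pderiv 1 (lenOne p Q) = aeval 𝐲 (derivative Q) := by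
  simp [lenOne]

end Basic

/-! ### Automorphisms fixing y, and uniqueness of mates. -/

section Triangular

variable {R : Type*} [CommRing R]

/-- Bivariate polynomials as polynomials in `x` over `R[y]`. -/
def toBi : MvPolynomial (Fin 2) R →ₐ[R] R[X][X] := MvPolynomial.aeval ![X, C X]

/-- The inverse of `toBi`. -/
def ofBi : R[X][X] →+* MvPolynomial (Fin 2) R :=
  Polynomial.eval₂RingHom (aeval (R := R) (𝐲 : MvPolynomial (Fin 2) R) : R[X] →+* _) 𝐱

lemma ofBi_toBi (P : MvPolynomial (Fin 2) R) : ofBi (toBi P) = P := by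
  induction P using MvPolynomial.induction_on with
  | C r => simp [ofBi, toBi, Polynomial.algebraMap_apply, MvPolynomial.algebraMap_eq]
  | add p q hp hq => simp [hp, hq]
  | mul_X p j hp => rw [map_mul, map_mul, hp]; fin_cases j <;> simp [ofBi, toBi]

lemma toBi_GA {σ : GA 2 R} (h : σ 𝐲 = 𝐲) (P : MvPolynomial (Fin 2) R) :
    toBi (σ P) = (toBi P).comp (toBi (σ 𝐱)) := by
  induction P using MvPolynomial.induction_on with
  | C r => simp [toBi, Polynomial.algebraMap_apply]
  | add p q hp hq => simp [hp, hq]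
  | mul_X p j hp =>
    rw [map_mul, map_mul, map_mul, hp, Polynomial.mul_comp]
    fin_cases j
    · simp [toBi]
    · simp [toBi, h]

/-- Over a domain, an automorphism fixing `y` is triangular. -/
lemma exists_eq_tri [IsDomain R] {σ : GA 2 R} (h : σ 𝐲 = 𝐲) :
    ∃ (u : Rˣ) (g : R[X]), σ = tri u g := by
  have h1 := toBi_GA h (σ⁻¹ 𝐱)
  rw [GA_apply_inv_self] at h1
  -- Degrees in x multiply under composition over the domain R[y], so σ(x) has degree 1 in x.
  have h2 := congrArg natDegree h1
  rw [Polynomial.natDegree_comp] at h2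
  have h3 : (toBi (σ 𝐱)).natDegree = 1 := by
    have : (toBi (𝐱 : MvPolynomial (Fin 2) R)).natDegree = 1 := by simp [toBi]
    rw [this] at h2
    exact Nat.eq_one_of_mul_eq_one_left h2.symm
  have h4 := congrArg ofBi (Polynomial.eq_X_add_C_of_natDegree_le_one h3.le)
  rw [ofBi_toBi] at h4
  set a := (toBi (σ 𝐱)).coeff 1
  set b := (toBi (σ 𝐱)).coeff 0
  have h5 : σ 𝐱 = aeval 𝐲 a * 𝐱 + aeval 𝐲 b := by
    rw [h4]; simp [ofBi]
  -- The coefficient a(y) of x in σ(x) is the Jacobian of σ, hence a unit constant.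
  obtain ⟨u, hu⟩ := jacobian_eq_C σ
  have h6 : jacobian (σ 𝐱) (σ 𝐲) = aeval 𝐲 a := by
    rw [h, h5]; simp [jacobian]
  refine ⟨u, b, GA_ext ?_ ?_⟩
  · rw [tri_x, h5, ← h6, hu, lenOne]
  · rw [tri_y, h]

/-- Two automorphisms with the same second component differ by a triangular one. -/
lemma exists_eq_mul_tri [IsDomain R] {σ τ : GA 2 R} (h : σ 𝐲 = τ 𝐲) :
    ∃ (u : Rˣ) (g : R[X]), σ = τ * tri u g := by
  obtain ⟨u, g, hg⟩ := exists_eq_tri (σ := τ⁻¹ * σ) (by rw [AlgEquiv.mul_apply, h]; simp)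
  exact ⟨u, g, by rw [← hg]; simp⟩

end Triangular

/-! ### Descent of affine relations between coordinates from K to R. -/

section Coordinates

variable {R : Type*} [CommRing R]

lemma C_mul_lenOne_add_C (c p w : R) (Q : R[X]) :
    MvPolynomial.C c * lenOne p Q + MvPolynomial.C w = lenOne (c * p) (C c * Q + C w) := by
  simp only [lenOne, map_mul, map_add, aeval_C, MvPolynomial.algebraMap_eq]
  ring

lemma lenOne_mem_B1 [IsDomain R] {p : R} (hp : p ≠ 0) (Q : R[X]) : lenOne p Q ∈ B1 R :=
  ⟨p, mem_nonZeroDivisors_of_ne_zero hp, Q, rfl⟩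

lemma exists_lenOne_of_mem_B1 [IsDomain R] {F : MvPolynomial (Fin 2) R} (h : F ∈ B1 R) :
    ∃ p Q, p ≠ 0 ∧ F = lenOne p Q := by
  obtain ⟨p, hp, Q, rfl⟩ := h
  exact ⟨p, Q, nonZeroDivisors.ne_zero hp, rfl⟩

/-- The automorphism `x ↦ x`, `y ↦ u y + w`. -/
def scaleY (u : Rˣ) (w : R) : GA 2 R := swap * tri u (C w) * swap

@[simp] lemma scaleY_x (u : Rˣ) (w : R) : scaleY u w 𝐱 = 𝐱 := by
  simp [scaleY]

@[simp] lemma scaleY_y (u : Rˣ) (w : R) :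
    scaleY u w 𝐲 = MvPolynomial.C (u : R) * 𝐲 + MvPolynomial.C w := by
  simp [scaleY, lenOne, MvPolynomial.algebraMap_eq]

/-- Normalizes a second component known only up to an R-affine change. Since `scaleY` fixes x, the
first component is untouched. -/
lemma scaleY_inv_apply_y (u : Rˣ) (w : R) (f : MvPolynomial (Fin 2) R) (σ : GA 2 R)
    (h : σ 𝐲 = MvPolynomial.C (u : R) * f + MvPolynomial.C w) :
    (σ * (scaleY u w)⁻¹) 𝐲 = f := by
  set σ' := σ * (scaleY u w)⁻¹
  have h1 : σ = σ' * scaleY u w := by simp [σ']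
  have h2 : MvPolynomial.C (u : R) * σ' 𝐲 = MvPolynomial.C (u : R) * f := by
    rw [h1, AlgEquiv.mul_apply, scaleY_y, map_add, map_mul, GA_apply_C, GA_apply_C] at h
    exact add_right_cancel h
  exact (u.isUnit.map MvPolynomial.C).mul_left_cancel h2

/-- Applying σ⁻¹ gives y = c·σ⁻¹(f) + w; compare the coefficients of y. -/
lemma isUnit_of_coordinate {g f : MvPolynomial (Fin 2) R} {c w : R} (hg : g ∈ VA₂ R)
    (h : g = MvPolynomial.C c * f + MvPolynomial.C w) : IsUnit c := by
  obtain ⟨σ, rfl⟩ := hg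
  have h1 := congrArg (fun P => (subst 0 X (σ⁻¹ P)).coeff 1) h
  simp at h1
  exact IsUnit.of_mul_eq_one _ h1.symm

/-- A coordinate over `R` that is a `K`-affine function of a primitive `p x + Q(y)` is an
`R`-affine function of it. -/
lemma coordinate_eq_of_map {K : Type*} [Field K] [Algebra R K] [IsDomain R]
    [UniqueFactorizationMonoid R] [IsFractionRing R K]
    {g : MvPolynomial (Fin 2) R} (hg : g ∈ VA₂ R) {p : R} {Q : R[X]} (hQ : Q.eval 0 = 0)
    (hpQ : IsRelPrime (C p) Q) {c s : K}
    (h : MvPolynomial.map (algebraMap R K) g =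
      MvPolynomial.C c * MvPolynomial.map (algebraMap R K) (lenOne p Q) + MvPolynomial.C s) :
    ∃ (u : Rˣ) (w : R), g = MvPolynomial.C (u : R) * lenOne p Q + MvPolynomial.C w := by
  have hinj := IsFractionRing.injective R K
  rw [map_lenOne, C_mul_lenOne_add_C] at h
  obtain ⟨p', Q', hg', hp', hQ'⟩ := exists_lenOne_of_map hinj h
  set w := Q'.eval 0
  have hs : algebraMap R K w = s := by
    have h1 := congrArg (Polynomial.eval 0) hQ'
    have h2 : algebraMap R K (Q.eval 0) = 0 := by rw [hQ, map_zero]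
    rw [← Polynomial.eval_zero_map] at h2
    rw [Polynomial.eval_zero_map, Polynomial.eval_add, Polynomial.eval_mul, h2, mul_zero, zero_add,
      Polynomial.eval_C] at h1
    exact h1
  set a := IsFractionRing.num R c
  set b := (IsFractionRing.den R c : R)
  have hb0 : algebraMap R K b ≠ 0 :=
    (map_ne_zero_iff _ hinj).2 (nonZeroDivisors.ne_zero (IsFractionRing.den R c).2)
  have hab : algebraMap R K b * c = algebraMap R K a := by
    conv_lhs => rw [← IsFractionRing.mk'_num_den' R c]
    exact mul_div_cancel₀ _ hb0
  have hrel : IsRelPrime b a := (IsFractionRing.num_den_reduced R c).symm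
  have e1 : b * p' = a * p := by
    apply hinj
    rw [map_mul, map_mul, hp', ← hab]; ring
  have e2 : C b * (Q' - C w) = C a * Q := by
    apply Polynomial.map_injective _ hinj
    simp only [Polynomial.map_mul, Polynomial.map_sub, Polynomial.map_C, hQ', hs, ← hab, C_mul]
    ring
  -- The denominator b of c is coprime to its numerator a, so it divides p and every coefficient of
  -- Q; primitivity of (p, Q) makes it a unit.
  have hbu : IsUnit b := by
    rw [← Polynomial.isUnit_C]
    apply hpQ
    · exact map_dvd C (hrel.dvd_of_dvd_mul_left ⟨p', e1.symm⟩)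
    · rw [Polynomial.C_dvd_iff_dvd_coeff]
      intro i
      apply hrel.dvd_of_dvd_mul_left
      have := congrArg (fun P => P.coeff i) e2
      simp only [Polynomial.coeff_C_mul] at this
      exact ⟨_, this.symm⟩
  obtain ⟨b', hb'⟩ := hbu
  have hg2 : g = MvPolynomial.C ((b'⁻¹ : Rˣ) * a) * lenOne p Q + MvPolynomial.C w := by
    rw [C_mul_lenOne_add_C, hg']
    congr 1
    · rw [mul_assoc, ← e1, ← hb']; simp
    · rw [C_mul, mul_assoc, ← e2, ← hb', ← mul_assoc, ← C_mul]; simp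
  obtain ⟨u, hu⟩ := isUnit_of_coordinate hg hg2
  exact ⟨u, w, by rw [hu, hg2]⟩

end Coordinates

/-! ### Coordinates p x + Q(y) and reduction modulo p. -/

section Reduction

variable {R : Type*} [CommRing R]

lemma exists_eq_add_C_mul {p : R} {P Q : R[X]}
    (h : P.map (Ideal.Quotient.mk (Ideal.span {p})) =
      Q.map (Ideal.Quotient.mk (Ideal.span {p}))) : ∃ E, P = Q + C p * E := by
  have : C p ∣ P - Q := by
    rw [Polynomial.C_dvd_iff_dvd_coeff]
    intro i
    have hi := congrArg (fun P => P.coeff i) h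
    simp only [Polynomial.coeff_map] at hi
    rw [Polynomial.coeff_sub, ← Ideal.mem_span_singleton]
    exact Ideal.Quotient.eq.1 hi
  obtain ⟨E, hE⟩ := this
  exact ⟨E, by rw [← hE]; ring⟩

lemma sub_dvd_aeval_sub {A : Type*} [CommRing A] [Algebra R A] (a b : A) (P : R[X]) :
    a - b ∣ aeval a P - aeval b P := by
  have := Polynomial.sub_dvd_eval_sub a b (P.map (algebraMap R A))
  simpa [Polynomial.eval_map_algebraMap] using this

lemma aeval_comp_add_C_mul {P Q E : R[X]} {p : R} (h : P.comp Q = X + C p * E)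
    (z : MvPolynomial (Fin 2) R) :
    aeval (aeval z Q) P = z + MvPolynomial.C p * aeval z E := by
  rw [← Polynomial.aeval_comp, h]
  simp [MvPolynomial.algebraMap_eq]

/-- If `Q` is a coordinate modulo `p`, then `p x + Q(y)` is a coordinate, with an explicit mate. -/
lemma exists_GA_of_mod_mem_VA₁ [IsDomain R] {p : R} (hp : p ≠ 0) {Q : R[X]}
    (h : Q.map (Ideal.Quotient.mk (Ideal.span {p})) ∈ VA₁ (R ⧸ Ideal.span {p})) :
    ∃ (σ : GA 2 R) (P : R[X]), σ 𝐲 = lenOne p Q ∧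
      MvPolynomial.C p * σ 𝐱 = 𝐲 - aeval (lenOne p Q) P := by
  obtain ⟨s, hs⟩ := h
  obtain ⟨P, hP⟩ := Polynomial.map_surjective (Ideal.Quotient.mk (Ideal.span {p}))
    Ideal.Quotient.mk_surjective (s.symm X)
  obtain ⟨E, hE⟩ : ∃ E, P.comp Q = X + C p * E := by
    apply exists_eq_add_C_mul
    rw [Polynomial.map_comp, hP, Polynomial.map_X, ← hs, Polynomial.comp_eq_aeval,
      Polynomial.aeval_algHom_apply s]
    simp
  obtain ⟨E', hE'⟩ : ∃ E, Q.comp P = X + C p * E := by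
    apply exists_eq_add_C_mul
    rw [Polynomial.map_comp, hP, Polynomial.map_X, ← hs, Polynomial.comp_eq_aeval,
      Polynomial.aeval_algHom_apply s.symm]
    simp
  set f := lenOne p Q
  -- Modulo p, f is Q(y), so P(f) is P(Q(y)) = y. The inverse automorphism is built below in the
  -- same way, with P and Q exchanged.
  obtain ⟨g, hg⟩ : ∃ g, MvPolynomial.C p * g = 𝐲 - aeval f P := by
    obtain ⟨k, hk⟩ := sub_dvd_aeval_sub f (aeval (𝐲 : MvPolynomial (Fin 2) R) Q) P
    rw [aeval_comp_add_C_mul hE] at hk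
    have hf : f - aeval 𝐲 Q = MvPolynomial.C p * 𝐱 := by simp [f, lenOne]
    rw [hf] at hk
    exact ⟨- (𝐱 * k) - aeval 𝐲 E, by linear_combination hk⟩
  set y' : MvPolynomial (Fin 2) R := lenOne p P with hy'
  obtain ⟨x', hx'⟩ : ∃ x', MvPolynomial.C p * x' = 𝐲 - aeval y' Q := by
    obtain ⟨k, hk⟩ := sub_dvd_aeval_sub y' (aeval (𝐲 : MvPolynomial (Fin 2) R) P) Q
    rw [aeval_comp_add_C_mul hE'] at hk
    have hf : y' - aeval 𝐲 P = MvPolynomial.C p * 𝐱 := by simp [y', lenOne]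
    rw [hf] at hk
    exact ⟨- (𝐱 * k) - aeval 𝐲 E', by linear_combination hk⟩
  have hp' : MvPolynomial.C (σ := Fin 2) p ≠ 0 := by simpa using hp
  have ay : MvPolynomial.aeval ![g, f] y' = 𝐲 := by
    rw [hy', apply_lenOne, MvPolynomial.aeval_X, MvPolynomial.aeval_X]
    simp only [MvPolynomial.algebraMap_eq, Matrix.cons_val_zero, Matrix.cons_val_one]
    rw [hg]; ring
  have hβf : MvPolynomial.aeval ![x', y'] f = 𝐲 := by
    rw [show f = lenOne p Q from rfl, apply_lenOne, MvPolynomial.aeval_X, MvPolynomial.aeval_X]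
    simp only [MvPolynomial.algebraMap_eq, Matrix.cons_val_zero, Matrix.cons_val_one]
    rw [hx']; ring
  have ax : MvPolynomial.aeval ![g, f] x' = 𝐱 := by
    apply mul_left_cancel₀ hp'
    have := congrArg (MvPolynomial.aeval ![g, f]) hx'
    rw [map_mul, map_sub, ← Polynomial.aeval_algHom_apply, ay, apply_C,
      MvPolynomial.aeval_X, MvPolynomial.algebraMap_eq] at this
    rw [this]
    simp [f, lenOne]
  have bx : MvPolynomial.aeval ![x', y'] g = 𝐱 := by
    apply mul_left_cancel₀ hp'
    have := congrArg (MvPolynomial.aeval ![x', y']) hg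
    rw [map_mul, map_sub, ← Polynomial.aeval_algHom_apply, hβf, apply_C,
      MvPolynomial.aeval_X, MvPolynomial.algebraMap_eq] at this
    rw [this]
    simp [y', lenOne]
  refine ⟨mkGA ![g, f] ![x', y'] ?_ ?_, P, ?_, ?_⟩
  · intro i; fin_cases i
    · exact ax
    · exact ay
  · intro i; fin_cases i
    · exact bx
    · exact hβf
  · simp
  · simpa using hg

/-- Iterating, D is divisible by every power of X. No reducedness or domain hypothesis is needed,
which matters for R/p₁R. -/
lemma eq_zero_of_eq_mul_self {A : Type*} [CommRing A] {D E : A[X]} (h : D = D * E)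
    (hE : E.coeff 0 = 0) : D = 0 := by
  ext n
  induction n using Nat.strong_induction_on with
  | _ n ih =>
    rw [h, Polynomial.coeff_mul, Polynomial.coeff_zero]
    apply Finset.sum_eq_zero
    rintro ⟨i, j⟩ hij
    rw [Finset.HasAntidiagonal.mem_antidiagonal] at hij
    dsimp only at hij ⊢
    rcases Nat.eq_zero_or_pos j with rfl | hj
    · rw [hE, mul_zero]
    · rw [ih i (by omega), Polynomial.coeff_zero, zero_mul]

/-- A univariate polynomial that is a coordinate of `A[x, y]` is a coordinate of `A[y]`. -/
lemma mem_VA₁_of_GA {A : Type*} [CommRing A] {ρ : GA 2 A} {q : A[X]}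
    (h : ρ 𝐲 = aeval 𝐲 q) : q ∈ VA₁ A := by
  set H := ρ⁻¹ 𝐲
  have hH : aeval H q = 𝐲 := by
    rw [← GA_aeval, ← h, GA_inv_apply_self]
  set W := toBi H
  set k := W.coeff 0
  set D := W - C k
  have hW : aeval W q = C X := by
    rw [Polynomial.aeval_algHom_apply, hH]; simp [toBi]
  have hCk : ∀ P : A[X], aeval (C k : A[X][X]) P = C (P.comp k) := by
    intro P
    have := Polynomial.aeval_algebraMap_apply A[X][X] k P
    rw [Polynomial.comp_eq_aeval]
    exact this
  -- Write H as k(y) + D with D divisible by x, and expand y = q(k + D) = q(k) + q'(k)D + zD².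
  -- Setting x = 0 gives q(k) = y. Differentiating this shows that q'(k) is a unit with inverse k',
  -- so D = -k'zD·D and therefore D = 0.
  obtain ⟨z, hz⟩ := Polynomial.binomExpansion (q.map (algebraMap A A[X][X])) (C k) D
  rw [show C k + D = W by simp [D]] at hz
  rw [Polynomial.derivative_map] at hz
  simp only [Polynomial.eval_map_algebraMap, hW, hCk] at hz
  have hD0 : D.coeff 0 = 0 := by simp [D, k]
  have hqk : q.comp k = X := by
    have := congrArg (fun P => P.coeff 0) hz
    simp [hD0, Polynomial.mul_coeff_zero, pow_two] at this
    exact this.symm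
  have hder : (derivative q).comp k * derivative k = 1 := by
    have := congrArg derivative hqk
    rw [Polynomial.derivative_comp, Polynomial.derivative_X] at this
    rw [mul_comm]; exact this
  have hDz : D = 0 := by
    apply eq_zero_of_eq_mul_self (E := - (C (derivative k) * z * D))
    · have hder' := congrArg (C : A[X] → A[X][X]) hder
      rw [C_mul, C_1] at hder'
      rw [hqk] at hz
      linear_combination (-C (derivative k)) * hz - D * hder'
    · simp [Polynomial.mul_coeff_zero, hD0]
  have hHk : H = aeval 𝐲 k := by
    rw [← ofBi_toBi H, show toBi H = C k from sub_eq_zero.1 hDz]; simp [ofBi]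
  have hkq : k.comp q = X := by
    have h1 : ρ H = 𝐲 := GA_apply_inv_self ρ 𝐲
    rw [hHk, GA_aeval, h] at h1
    have h2 := congrArg (subst 0 X) h1
    simpa [subst_aeval] using h2
  exact ⟨Polynomial.algEquivOfCompEqX q k hqk hkq, by simp⟩

lemma mod_mem_VA₁_of_mem_VA₂ {p : R} {Q : R[X]} (h : lenOne p Q ∈ VA₂ R) :
    Q.map (Ideal.Quotient.mk (Ideal.span {p})) ∈ VA₁ (R ⧸ Ideal.span {p}) := by
  obtain ⟨σ, hσ⟩ := h
  apply mem_VA₁_of_GA (ρ := baseChange (Ideal.Quotient.mk (Ideal.span {p})) σ)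
  have hp : Ideal.Quotient.mk (Ideal.span {p}) p = 0 :=
    Ideal.Quotient.eq_zero_iff_mem.2 (Ideal.mem_span_singleton_self p)
  rw [baseChange_X, hσ, map_lenOne, lenOne, hp]
  simp

end Reduction

/-! ### The automorphism (f, F) over the fraction field. -/

section Field

variable {K : Type*} [Field K]

/-- The automorphism `x ↦ y`, `y ↦ p x + Q(y)`. -/
def lenOneGA {p : K} (hp : p ≠ 0) (Q : K[X]) : GA 2 K := tri (Units.mk0 p hp) Q * swap

@[simp] lemma lenOneGA_x {p : K} (hp : p ≠ 0) (Q : K[X]) : lenOneGA hp Q 𝐱 = 𝐲 := by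
  simp [lenOneGA]

@[simp] lemma lenOneGA_y {p : K} (hp : p ≠ 0) (Q : K[X]) : lenOneGA hp Q 𝐲 = lenOne p Q := by
  simp [lenOneGA]

/-- The automorphism `x ↦ p₁ x + Q₁(y)`, `y ↦ p₂ y + Q₂(p₁ x + Q₁(y))`. -/
def length2GA {p₁ p₂ : K} (h₁ : p₁ ≠ 0) (h₂ : p₂ ≠ 0) (Q₁ Q₂ : K[X]) : GA 2 K :=
  lenOneGA h₁ Q₁ * lenOneGA h₂ Q₂

@[simp] lemma length2GA_x {p₁ p₂ : K} (h₁ : p₁ ≠ 0) (h₂ : p₂ ≠ 0) (Q₁ Q₂ : K[X]) :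
    length2GA h₁ h₂ Q₁ Q₂ 𝐱 = lenOne p₁ Q₁ := by
  simp [length2GA]

@[simp] lemma length2GA_y {p₁ p₂ : K} (h₁ : p₁ ≠ 0) (h₂ : p₂ ≠ 0) (Q₁ Q₂ : K[X]) :
    length2GA h₁ h₂ Q₁ Q₂ 𝐲 = length2Poly p₁ p₂ Q₁ Q₂ := by
  rw [length2GA, AlgEquiv.mul_apply, lenOneGA_y, GA_lenOne, lenOneGA_x, lenOneGA_y]
  rfl

lemma length2Poly_eq (p₁ p₂ : K) (Q₁ Q₂ : K[X]) :
    length2Poly p₁ p₂ Q₁ Q₂ = MvPolynomial.C p₂ * 𝐲 + aeval (lenOne p₁ Q₁) Q₂ := rfl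

lemma jacobian_length2Poly (p₁ p₂ : K) (Q₁ Q₂ : K[X]) :
    jacobian (lenOne p₁ Q₁) (length2Poly p₁ p₂ Q₁ Q₂) = MvPolynomial.C (p₁ * p₂) := by
  simp only [jacobian, length2Poly_eq, map_add, pderiv_aeval, pderiv_zero_lenOne,
    pderiv_one_lenOne, MvPolynomial.pderiv_C_mul, MvPolynomial.pderiv_X_self,
    MvPolynomial.pderiv_X_of_ne (show (1 : Fin 2) ≠ 0 by decide), map_mul]
  ring

lemma subst_length2Poly (a b : K[X]) (p₁ p₂ : K) (Q₁ Q₂ : K[X]) :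
    subst a b (length2Poly p₁ p₂ Q₁ Q₂) = C p₂ * b + Q₂.comp (C p₁ * a + Q₁.comp b) := by
  rw [length2Poly_eq, map_add, map_mul, subst_aeval]; simp

end Field

/-- Mates of a given coordinate over a domain. -/
lemma mate_eq {R : Type*} [CommRing R] [IsDomain R] {σ τ : GA 2 R} (h : σ 𝐲 = τ 𝐲) :
    ∃ (u : Rˣ) (g : R[X]), σ 𝐱 = MvPolynomial.C (u : R) * τ 𝐱 + aeval (τ 𝐲) g := by
  obtain ⟨u, g, rfl⟩ := exists_eq_mul_tri h
  exact ⟨u, g, by simp [GA_lenOne]⟩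

/-! ### Mates of length one and length "1+1". -/

section FractionField

variable {R K : Type*} [CommRing R] [IsDomain R] [Field K] [Algebra R K] [IsFractionRing R K]
  {p₁ : R} {p₂ : K} {Q₁ : R[X]} {Q₂ : K[X]} {F : MvPolynomial (Fin 2) R}

/-- If `F` has a mate of length one, then `p₁ x + Q₁(y)` is such a mate. -/
lemma exists_GA_of_hasMate [UniqueFactorizationMonoid R] (hp₁ : p₁ ≠ 0) (hp₂ : p₂ ≠ 0)
    (hQ₁ : Q₁.eval 0 = 0) (hgcd : IsRelPrime (C p₁) Q₁) (hn : 2 ≤ Q₂.natDegree)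
    (hF : MvPolynomial.map (algebraMap R K) F =
      length2Poly (algebraMap R K p₁) p₂ (Q₁.map (algebraMap R K)) Q₂)
    (h : HasMateOfLengthOne F) : ∃ σ : GA 2 R, σ 𝐱 = F ∧ σ 𝐲 = lenOne p₁ Q₁ := by
  obtain ⟨G, hG, σ, hσx, hσy⟩ := h
  obtain ⟨p, Q, hp, rfl⟩ := exists_lenOne_of_mem_B1 hG
  have hinj := IsFractionRing.injective R K
  have hp₁' : algebraMap R K p₁ ≠ 0 := (map_ne_zero_iff _ hinj).2 hp₁
  obtain ⟨u, k, hk⟩ := mate_eq (σ := baseChange (algebraMap R K) σ * swap)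
    (τ := length2GA hp₁' hp₂ (Q₁.map (algebraMap R K)) Q₂) (by simp [hσx, hF])
  simp only [AlgEquiv.mul_apply, swap_x, baseChange_X, hσy, length2GA_x, length2GA_y] at hk
  -- At y = 0 the mate is linear in x and f becomes p₁x, so k(Q₂(p₁x)) has degree at most 1, while
  -- deg Q₂ ≥ 2.
  have hk0 : k.natDegree = 0 := by
    have h1 := congrArg (subst X 0) hk
    rw [map_lenOne, map_add, map_mul, subst_aeval, subst_length2Poly, subst_lenOne, subst_lenOne,
      subst_C] at h1
    have hq : ∀ P : K[X], P.comp 0 = C (P.eval 0) := fun P => by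
      rw [← C_0, Polynomial.comp_C]
    have hz : (Q₁.map (algebraMap R K)).comp 0 = 0 := by
      rw [hq, Polynomial.eval_zero_map, hQ₁, map_zero, map_zero]
    rw [hz, mul_zero, zero_add, add_zero] at h1
    have h2 : (k.comp (Q₂.comp (C (algebraMap R K p₁) * X))).natDegree ≤ 1 := by
      have : k.comp (Q₂.comp (C (algebraMap R K p₁) * X)) =
          C (algebraMap R K p - u * algebraMap R K p₁) * X +
            C ((Q.map (algebraMap R K)).eval 0) := by
        rw [← hq, C_sub, C_mul]; linear_combination -h1
      rw [this]; exact Polynomial.natDegree_linear_le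
    rw [Polynomial.natDegree_comp, Polynomial.natDegree_comp,
      Polynomial.natDegree_C_mul_X _ hp₁'] at h2
    by_contra hne
    have : 1 ≤ k.natDegree := Nat.one_le_iff_ne_zero.2 hne
    nlinarith
  rw [Polynomial.eq_C_of_natDegree_eq_zero hk0, aeval_C, MvPolynomial.algebraMap_eq,
    ← map_lenOne] at hk
  obtain ⟨v, w, hvw⟩ := coordinate_eq_of_map ⟨σ, hσy⟩ hQ₁ hgcd hk
  refine ⟨σ * (scaleY v w)⁻¹, ?_, scaleY_inv_apply_y v w _ σ (hσy.trans hvw)⟩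
  rw [AlgEquiv.mul_apply, GA_inv_apply_eq.2 (scaleY_x v w).symm, hσx]

/-- The Jacobian of (f, F) is p₁p₂ over K, and a unit of R once f is a mate of F over R. -/
lemma mul_eq_unit_of_hasMate [UniqueFactorizationMonoid R] (hp₁ : p₁ ≠ 0) (hp₂ : p₂ ≠ 0)
    (hQ₁ : Q₁.eval 0 = 0) (hgcd : IsRelPrime (C p₁) Q₁) (hn : 2 ≤ Q₂.natDegree)
    (hF : MvPolynomial.map (algebraMap R K) F =
      length2Poly (algebraMap R K p₁) p₂ (Q₁.map (algebraMap R K)) Q₂)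
    (h : HasMateOfLengthOne F) : ∃ u : Rˣ, algebraMap R K p₁ * p₂ = algebraMap R K (u : R) := by
  obtain ⟨σ, hx, hy⟩ := exists_GA_of_hasMate hp₁ hp₂ hQ₁ hgcd hn hF h
  obtain ⟨u, hu⟩ := jacobian_eq_C (σ * swap)
  have h1 := congrArg (MvPolynomial.map (algebraMap R K)) hu
  rw [← jacobian_map] at h1
  simp only [AlgEquiv.mul_apply, swap_x, swap_y, hx, hy, hF, map_lenOne, jacobian_length2Poly,
    MvPolynomial.map_C] at h1
  exact ⟨u, MvPolynomial.C_injective _ _ h1⟩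

/-- With F = ρ(y), uniqueness of mates over K gives ρ⁻¹(f) = c x + g(y). The left side is over R, so
c and g are too. The Jacobian p₁p₂ is c times a unit, so c is a unit and f is a mate of F. -/
lemma hasMate_of_mul_eq_unit (hp₁ : p₁ ≠ 0) (hp₂ : p₂ ≠ 0)
    (hF : MvPolynomial.map (algebraMap R K) F =
      length2Poly (algebraMap R K p₁) p₂ (Q₁.map (algebraMap R K)) Q₂)
    (hcoord : F ∈ VA₂ R) {u : Rˣ} (hu : algebraMap R K p₁ * p₂ = algebraMap R K (u : R)) :
    HasMateOfLengthOne F := by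
  obtain ⟨ρ, hρ⟩ := hcoord
  have hinj := IsFractionRing.injective R K
  have hp₁' : algebraMap R K p₁ ≠ 0 := (map_ne_zero_iff _ hinj).2 hp₁
  obtain ⟨c, g, hcg⟩ := exists_eq_mul_tri
    (σ := length2GA hp₁' hp₂ (Q₁.map (algebraMap R K)) Q₂) (τ := baseChange (algebraMap R K) ρ)
    (by simp [hρ, hF])
  have h1 := DFunLike.congr_fun hcg 𝐱
  rw [length2GA_x, AlgEquiv.mul_apply, tri_x] at h1
  have h2 : MvPolynomial.map (algebraMap R K) (ρ⁻¹ (lenOne p₁ Q₁)) = lenOne (c : K) g := by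
    apply (baseChange (algebraMap R K) ρ).injective
    rw [baseChange_map, GA_apply_inv_self, map_lenOne, h1]
  obtain ⟨c', g', hc'g', hc', -⟩ := exists_lenOne_of_map hinj h2
  obtain ⟨v, hv⟩ := jacobian_eq_C ρ
  have h3 : lenOne p₁ Q₁ = ρ (lenOne c' g') := GA_inv_apply_eq.1 hc'g'
  have h4 : jacobian (lenOne p₁ Q₁) F = MvPolynomial.C (c' * (v : R)) := by
    rw [h3, ← hρ, jacobian_GA, hv]
    simp [jacobian, pderiv_zero_lenOne]
  have h5 := congrArg (MvPolynomial.map (algebraMap R K)) h4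
  rw [← jacobian_map, map_lenOne, hF, jacobian_length2Poly, MvPolynomial.map_C, hu] at h5
  have h6 : (u : R) = c' * v := hinj (MvPolynomial.C_injective _ _ h5)
  have h7 : IsUnit c' := isUnit_of_mul_isUnit_left (h6 ▸ u.isUnit)
  obtain ⟨c'', rfl⟩ := h7
  refine ⟨lenOne p₁ Q₁, lenOne_mem_B1 hp₁ Q₁, ρ * tri c'' g' * swap, ?_, ?_⟩
  · simp [hρ]
  · simp [h3]

lemma mem_VA₂_of_hasLengthOnePlusOne [UniqueFactorizationMonoid R] (hp₁ : p₁ ≠ 0)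
    (hQ₁ : Q₁.eval 0 = 0) (hQ₂ : Q₂.eval 0 = 0) (hgcd : IsRelPrime (C p₁) Q₁)
    (hn : 2 ≤ Q₂.natDegree)
    (hF : MvPolynomial.map (algebraMap R K) F =
      length2Poly (algebraMap R K p₁) p₂ (Q₁.map (algebraMap R K)) Q₂)
    (h : HasLengthOnePlusOne F) : lenOne p₁ Q₁ ∈ VA₂ R := by
  obtain ⟨σ, τ, hσ, hτ, hστ⟩ := h
  obtain ⟨a, A, ha, hσ⟩ := exists_lenOne_of_mem_B1 hσ
  obtain ⟨b, B, hb, hτ⟩ := exists_lenOne_of_mem_B1 hτ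
  have hinj := IsFractionRing.injective R K
  have hp₁' : algebraMap R K p₁ ≠ 0 := (map_ne_zero_iff _ hinj).2 hp₁
  have ha' : algebraMap R K a ≠ 0 := (map_ne_zero_iff _ hinj).2 ha
  rw [AlgEquiv.mul_apply, hτ, GA_lenOne, hσ] at hστ
  obtain ⟨c, S, hS⟩ := mate_eq (σ := baseChange (algebraMap R K) σ)
    (τ := lenOneGA ha' (A.map (algebraMap R K))) (by simp [hσ, map_lenOne])
  rw [baseChange_X, lenOneGA_x, lenOneGA_y] at hS
  set q₁ := Q₁.map (algebraMap R K)
  set A' := A.map (algebraMap R K)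
  set T := C (algebraMap R K b) * S + B.map (algebraMap R K) with hT
  -- With g = σ(y) = a x + A(y), σ(x) is c y + S(g) over K, so F has a second expression b c y +
  -- T(g).
  have hE : MvPolynomial.C (algebraMap R K b * c) * 𝐲 + aeval (lenOne (algebraMap R K a) A') T =
      length2Poly (algebraMap R K p₁) p₂ q₁ Q₂ := by
    have h1 := congrArg (MvPolynomial.map (algebraMap R K)) hστ
    rw [hF, map_add, map_mul, MvPolynomial.map_C, hS, map_aeval_eq, map_lenOne] at h1
    rw [← h1, hT]
    simp only [map_add, map_mul, aeval_C, MvPolynomial.algebraMap_eq]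
    ring
  have hq : ∀ P : K[X], P.comp 0 = C (P.eval 0) := fun P => by
    rw [← C_0, Polynomial.comp_C]
  have hz : q₁.eval 0 = 0 := by rw [Polynomial.eval_zero_map, hQ₁, map_zero]
  -- At y = 0 both g and f are of degree 1 in x.
  have hTn : T.natDegree = Q₂.natDegree := by
    have h1 := congrArg (subst X 0) hE
    rw [map_add, map_mul, subst_aeval, subst_lenOne, subst_length2Poly, subst_y, hq, hq, hz,
      mul_zero, mul_zero, zero_add, zero_add, C_0, add_zero] at h1
    have h2 := congrArg natDegree h1
    rwa [Polynomial.natDegree_comp, Polynomial.natDegree_comp, Polynomial.natDegree_linear ha',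
      Polynomial.natDegree_C_mul_X _ hp₁', mul_one, mul_one] at h2
  -- D is the value of g at x = -Q₁(y)/p₁, where f vanishes. There F becomes p₂y because Q₂(0) = 0,
  -- so T(D) has degree at most 1. As deg T ≥ 2, D is constant, which says that g is K-affine in f.
  set D := C (algebraMap R K a) * (C (-(algebraMap R K p₁)⁻¹) * q₁) + A' with hD
  have hD0 : D.natDegree = 0 := by
    have h0 : C (algebraMap R K p₁) * (C (-(algebraMap R K p₁)⁻¹) * q₁) + q₁ = 0 := by
      rw [← mul_assoc, ← C_mul, mul_neg, mul_inv_cancel₀ hp₁']; simp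
    have h1 := congrArg (subst (C (-(algebraMap R K p₁)⁻¹) * q₁) X) hE
    rw [map_add, map_mul, subst_aeval, subst_lenOne, subst_length2Poly, subst_y, subst_C,
      Polynomial.comp_X, Polynomial.comp_X, h0, hq, hQ₂, C_0, add_zero, ← hD] at h1
    have h2 : (T.comp D).natDegree ≤ 1 := by
      have : T.comp D = C (p₂ - algebraMap R K b * c) * X + C 0 := by
        rw [C_sub, C_0]; linear_combination h1
      rw [this]; exact Polynomial.natDegree_linear_le
    rw [Polynomial.natDegree_comp, hTn] at h2
    by_contra hne
    have : 1 ≤ D.natDegree := Nat.one_le_iff_ne_zero.2 hne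
    nlinarith
  have hA : A' = C (algebraMap R K a * (algebraMap R K p₁)⁻¹) * q₁ + C (D.coeff 0) := by
    rw [← Polynomial.eq_C_of_natDegree_eq_zero hD0, hD]
    simp only [C_mul, C_neg]; ring
  have hg : MvPolynomial.map (algebraMap R K) (lenOne a A) =
      MvPolynomial.C (algebraMap R K a * (algebraMap R K p₁)⁻¹) *
        MvPolynomial.map (algebraMap R K) (lenOne p₁ Q₁) + MvPolynomial.C (D.coeff 0) := by
    rw [map_lenOne, map_lenOne, C_mul_lenOne_add_C, ← hA, inv_mul_cancel_right₀ hp₁']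
  obtain ⟨u, w, huw⟩ := coordinate_eq_of_map ⟨σ, hσ⟩ hQ₁ hgcd hg
  exact ⟨_, scaleY_inv_apply_y u w _ σ (hσ.trans huw)⟩

/-- With σ(y) = f and σ(x) = (y - P(f))/p₁, substituting y = p₁σ(x) + P(f) in F gives σ⁻¹(F) = p₁p₂x
+ p₂P(y) + Q₂(y). Its coefficients lie in R because F and σ are defined over R. -/
lemma hasLengthOnePlusOne_of_mod (hp₁ : p₁ ≠ 0) (hp₂ : p₂ ≠ 0)
    (hF : MvPolynomial.map (algebraMap R K) F =
      length2Poly (algebraMap R K p₁) p₂ (Q₁.map (algebraMap R K)) Q₂)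
    (hcoord : F ∈ VA₂ R)
    (h : Q₁.map (Ideal.Quotient.mk (Ideal.span {p₁})) ∈ VA₁ (R ⧸ Ideal.span {p₁})) :
    HasLengthOnePlusOne F := by
  obtain ⟨ρ, hρ⟩ := hcoord
  obtain ⟨σ, P, hσy, hσx⟩ := exists_GA_of_mod_mem_VA₁ hp₁ h
  have hinj := IsFractionRing.injective R K
  have h1 : MvPolynomial.map (algebraMap R K) (σ⁻¹ F) =
      lenOne (algebraMap R K p₁ * p₂) (C p₂ * P.map (algebraMap R K) + Q₂) := by
    apply (baseChange (algebraMap R K) σ).injective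
    have h2 := congrArg (MvPolynomial.map (algebraMap R K)) hσx
    rw [map_mul, map_sub, MvPolynomial.map_C, MvPolynomial.map_X, map_aeval_eq, map_lenOne] at h2
    rw [baseChange_map, GA_apply_inv_self, hF, GA_lenOne, baseChange_X, baseChange_X, hσy,
      length2Poly_eq, map_lenOne]
    simp only [map_add, map_mul, aeval_C, MvPolynomial.algebraMap_eq]
    linear_combination (-MvPolynomial.C p₂) * h2
  obtain ⟨b, B, hbB, hb, -⟩ := exists_lenOne_of_map hinj h1
  have hb0 : b ≠ 0 := by
    rintro rfl
    rw [map_zero, eq_comm, mul_eq_zero] at hb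
    exact hb.elim ((map_ne_zero_iff _ hinj).2 hp₁) hp₂
  refine ⟨σ, σ⁻¹ * ρ, hσy ▸ lenOne_mem_B1 hp₁ Q₁, ?_, ?_⟩
  · rw [AlgEquiv.mul_apply, hρ, hbB]; exact lenOne_mem_B1 hb0 B
  · simp [hρ]

end FractionField

/-! ### Total degrees under substitution and automorphisms. -/

section Degree

variable {R : Type*} [CommRing R]

lemma totalDegree_map_of_injective {S : Type*} [CommRing S] {φ : R →+* S}
    (hφ : Function.Injective φ) (P : MvPolynomial (Fin 2) R) :
    (MvPolynomial.map φ P).totalDegree = P.totalDegree := by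
  rw [MvPolynomial.totalDegree, MvPolynomial.totalDegree,
    MvPolynomial.support_map_of_injective _ hφ]

lemma totalDegree_C_mul_of_ne_zero [IsDomain R] {c : R} (hc : c ≠ 0)
    (P : MvPolynomial (Fin 2) R) : (MvPolynomial.C c * P).totalDegree = P.totalDegree := by
  rcases eq_or_ne P 0 with rfl | hP
  · simp
  · rw [MvPolynomial.totalDegree_mul_of_isDomain (by simpa using hc) hP,
      MvPolynomial.totalDegree_C, zero_add]

lemma totalDegree_C_mul_le (c : R) (P : MvPolynomial (Fin 2) R) :
    (MvPolynomial.C c * P).totalDegree ≤ P.totalDegree := by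
  refine (MvPolynomial.totalDegree_mul _ _).trans ?_
  simp

lemma totalDegree_aeval_le (P : MvPolynomial (Fin 2) R) (Q : R[X]) :
    (aeval P Q).totalDegree ≤ Q.natDegree * P.totalDegree := by
  rw [Polynomial.aeval_eq_sum_range]
  refine (MvPolynomial.totalDegree_finsetSum _ _).trans (Finset.sup_le fun i hi => ?_)
  refine (MvPolynomial.totalDegree_smul_le _ _).trans ?_
  refine (MvPolynomial.totalDegree_pow _ _).trans ?_
  exact Nat.mul_le_mul_right _ (Nat.lt_succ_iff.1 (Finset.mem_range.1 hi))

lemma totalDegree_pow_eq [IsDomain R] (P : MvPolynomial (Fin 2) R) (n : ℕ) :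
    (P ^ n).totalDegree = n * P.totalDegree := by
  rcases eq_or_ne P 0 with rfl | hP
  · rcases n with _ | n <;> simp
  induction n with
  | zero => simp
  | succ n ih =>
    rw [pow_succ, MvPolynomial.totalDegree_mul_of_isDomain (pow_ne_zero n hP) hP, ih]; ring

lemma totalDegree_aeval [IsDomain R] {P : MvPolynomial (Fin 2) R} (hP : 1 ≤ P.totalDegree)
    (Q : R[X]) : (aeval P Q).totalDegree = Q.natDegree * P.totalDegree := by
  rcases Nat.eq_zero_or_pos Q.natDegree with h0 | hpos
  · rw [h0, zero_mul, Polynomial.eq_C_of_natDegree_eq_zero h0, aeval_C,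
      MvPolynomial.algebraMap_eq, MvPolynomial.totalDegree_C]
  have hQ : Q ≠ 0 := by rintro rfl; simp at hpos
  have htop : (MvPolynomial.C Q.leadingCoeff * P ^ Q.natDegree).totalDegree =
      Q.natDegree * P.totalDegree := by
    rw [totalDegree_C_mul_of_ne_zero (leadingCoeff_ne_zero.2 hQ), totalDegree_pow_eq]
  have hsum : aeval P Q = MvPolynomial.C Q.leadingCoeff * P ^ Q.natDegree +
      aeval P Q.eraseLead := by
    have h := congrArg (aeval P) (Polynomial.eraseLead_add_C_mul_X_pow Q)
    rw [map_add, map_mul, aeval_C, map_pow, aeval_X, MvPolynomial.algebraMap_eq] at h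
    rw [← h, add_comm]
  rw [hsum, MvPolynomial.totalDegree_add_eq_left_of_totalDegree_lt, htop]
  rw [htop]
  rcases Polynomial.eraseLead_natDegree_lt_or_eraseLead_eq_zero Q with h | h
  · exact (totalDegree_aeval_le _ _).trans_lt (Nat.mul_lt_mul_of_pos_right h hP)
  · rw [h, map_zero, MvPolynomial.totalDegree_zero]
    exact Nat.mul_pos hpos hP

lemma one_le_totalDegree_GA [IsDomain R] (σ : GA 2 R) (i : Fin 2) :
    1 ≤ (σ (MvPolynomial.X i)).totalDegree := by
  rw [Nat.one_le_iff_ne_zero]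
  intro h
  rw [MvPolynomial.totalDegree_eq_zero_iff_eq_C] at h
  have h2 : (MvPolynomial.X i : MvPolynomial (Fin 2) R) = MvPolynomial.C _ :=
    σ.injective (h.trans (GA_apply_C σ _).symm)
  have h3 := congrArg MvPolynomial.totalDegree h2
  simp at h3

lemma natDegree_subst_le {a b : R[X]} (ha : a.natDegree ≤ 1) (hb : b.natDegree ≤ 1)
    (P : MvPolynomial (Fin 2) R) : (subst a b P).natDegree ≤ P.totalDegree := by
  have := MvPolynomial.aeval_natDegree_le P le_rfl ![a, b] (n := 1)
    (fun i => by fin_cases i <;> simpa)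
  rwa [mul_one] at this

end Degree

/-! ### Affine and triangular automorphisms as groups. -/

section Affine

variable {R : Type*} [CommRing R]

/-- The polynomial `a x + b y + c`. -/
def lin (a b c : R) : MvPolynomial (Fin 2) R := lenOne a (C b * X + C c)

lemma lin_eq (a b c : R) : lin a b c =
    MvPolynomial.C a * 𝐱 + MvPolynomial.C b * 𝐲 + MvPolynomial.C c := by
  simp [lin, lenOne, MvPolynomial.algebraMap_eq, add_assoc]

lemma GA_lin (σ : GA 2 R) (a b c : R) : σ (lin a b c) =
    MvPolynomial.C a * σ 𝐱 + MvPolynomial.C b * σ 𝐲 + MvPolynomial.C c := by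
  simp [lin_eq]

lemma totalDegree_lin_le [IsDomain R] (a b c : R) : (lin a b c).totalDegree ≤ 1 := by
  rw [lin_eq]
  refine (MvPolynomial.totalDegree_add _ _).trans (max_le ?_ (by simp))
  refine (MvPolynomial.totalDegree_add _ _).trans (max_le ?_ ?_) <;>
  exact (totalDegree_C_mul_le _ _).trans (by simp)

lemma exists_lin_of_totalDegree_le {P : MvPolynomial (Fin 2) R} (h : P.totalDegree ≤ 1) :
    ∃ a b c, P = lin a b c := by
  rw [← MvPolynomial.support_sum_monomial_coeff P]
  refine Finset.sum_induction _ (fun P => ∃ a b c, P = lin a b c) ?_ ⟨0, 0, 0, by simp [lin_eq]⟩ ?_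
  · rintro _ _ ⟨a, b, c, rfl⟩ ⟨a', b', c', rfl⟩
    exact ⟨a + a', b + b', c + c', by simp only [lin_eq, map_add]; ring⟩
  · intro m hm
    have h1 := (MvPolynomial.le_totalDegree hm).trans h
    rw [Finsupp.sum_fintype _ _ (fun _ => rfl), Fin.sum_univ_two] at h1
    have hm : m = Finsupp.single 0 (m 0) + Finsupp.single 1 (m 1) := by
      ext i; fin_cases i <;> simp
    generalize P.coeff m = r
    generalize m 0 = i at hm h1
    generalize m 1 = j at hm h1
    subst hm
    obtain ⟨rfl, rfl⟩ | ⟨rfl, rfl⟩ | ⟨rfl, rfl⟩ :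
        (i = 0 ∧ j = 0) ∨ (i = 1 ∧ j = 0) ∨ (i = 0 ∧ j = 1) := by omega
    · exact ⟨0, 0, r, by simp [lin_eq]⟩
    · exact ⟨r, 0, 0, by simp [lin_eq, MvPolynomial.C_mul_X_eq_monomial]⟩
    · exact ⟨0, r, 0, by simp [lin_eq, MvPolynomial.C_mul_X_eq_monomial]⟩

lemma mem_Aff_iff [IsDomain R] {σ : GA 2 R} :
    σ ∈ Aff 2 R ↔ (∃ a b c, σ 𝐱 = lin a b c) ∧ ∃ a b c, σ 𝐲 = lin a b c := by
  constructor
  · intro h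
    exact ⟨exists_lin_of_totalDegree_le (h 0).le, exists_lin_of_totalDegree_le (h 1).le⟩
  · rintro ⟨⟨a, b, c, h0⟩, ⟨a', b', c', h1⟩⟩ i
    apply le_antisymm _ (one_le_totalDegree_GA σ i)
    fin_cases i
    · exact h0 ▸ totalDegree_lin_le a b c
    · exact h1 ▸ totalDegree_lin_le a' b' c'

lemma jacobian_lin (a b c a' b' c' : R) :
    jacobian (lin a b c) (lin a' b' c') = MvPolynomial.C (a * b' - b * a') := by
  simp [jacobian, lin_eq]

lemma exists_det_unit [IsDomain R] {σ : GA 2 R} {a b c a' b' c' : R} (hx : σ 𝐱 = lin a b c)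
    (hy : σ 𝐲 = lin a' b' c') : ∃ u : Rˣ, a * b' - b * a' = u := by
  obtain ⟨u, hu⟩ := jacobian_eq_C σ
  rw [hx, hy, jacobian_lin] at hu
  exact ⟨u, MvPolynomial.C_injective _ _ hu⟩

/-- Inversion of an affine substitution with unit determinant. -/
lemma lin_comp_lin {a b c a' b' c' : R} {u : Rˣ} (h : a * b' - b * a' = u)
    {A : Type*} [CommRing A] [Algebra R A] {X Y X' Y' : A}
    (hX : X' = algebraMap R A a * X + algebraMap R A b * Y + algebraMap R A c)
    (hY : Y' = algebraMap R A a' * X + algebraMap R A b' * Y + algebraMap R A c') :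
    algebraMap R A (u⁻¹ * b' : R) * X' + algebraMap R A (-(u⁻¹ * b) : R) * Y' +
        algebraMap R A (u⁻¹ * (b * c' - b' * c) : R) = X ∧
      algebraMap R A (-(u⁻¹ * a') : R) * X' + algebraMap R A (u⁻¹ * a : R) * Y' +
        algebraMap R A (u⁻¹ * (a' * c - a * c') : R) = Y := by
  have h1 : algebraMap R A (u⁻¹ : Rˣ) * (algebraMap R A a * algebraMap R A b' -
      algebraMap R A b * algebraMap R A a') = 1 := by
    rw [← map_mul, ← map_mul, ← map_sub, h, ← map_mul]; simp
  subst hX hY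
  simp only [map_mul, map_neg, map_sub]
  constructor
  · linear_combination X * h1
  · linear_combination Y * h1

lemma lin_eq' (a b c : R) : lin a b c =
    algebraMap R _ a * 𝐱 + algebraMap R _ b * 𝐲 + algebraMap R _ c := lin_eq a b c

lemma exists_GA_lin {a b c a' b' c' : R} {u : Rˣ} (h : a * b' - b * a' = u) :
    ∃ σ : GA 2 R, σ 𝐱 = lin a b c ∧ σ 𝐲 = lin a' b' c' := by
  have h1 := lin_comp_lin h (lin_eq' a b c) (lin_eq' a' b' c')
  have h3 : ∀ (v : Fin 2 → MvPolynomial (Fin 2) R) (a b c : R),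
      MvPolynomial.aeval v (lin a b c) =
        algebraMap R _ a * v 0 + algebraMap R _ b * v 1 + algebraMap R _ c := by
    intro v a b c
    rw [lin_eq, map_add, map_add, map_mul, map_mul, apply_C, apply_C, apply_C,
      MvPolynomial.aeval_X, MvPolynomial.aeval_X]
  refine ⟨mkGA ![lin a b c, lin a' b' c']
    ![lin (u⁻¹ * b') (-(u⁻¹ * b)) (u⁻¹ * (b * c' - b' * c)),
      lin (-(u⁻¹ * a')) (u⁻¹ * a) (u⁻¹ * (a' * c - a * c'))] ?_ ?_,
    mkGA_X _ _ _ _ 0, mkGA_X _ _ _ _ 1⟩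
  · intro i
    fin_cases i
    · exact (h3 _ _ _ _).trans h1.1
    · exact (h3 _ _ _ _).trans h1.2
  · have hC : MvPolynomial.C (σ := Fin 2) (a * b' - b * a') * MvPolynomial.C ((u⁻¹ : Rˣ) : R) =
        1 := by
      rw [← map_mul, h]; simp
    simp only [map_mul, map_sub] at hC
    intro i
    fin_cases i
    · refine (h3 _ _ _ _).trans ?_
      simp only [Matrix.cons_val_zero, Matrix.cons_val_one, lin_eq, MvPolynomial.algebraMap_eq,
        map_mul, map_neg, map_sub]
      simp only [Fin.zero_eta]
      linear_combination (𝐱 - MvPolynomial.C c) * hC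
    · refine (h3 _ _ _ _).trans ?_
      simp only [Matrix.cons_val_zero, Matrix.cons_val_one, lin_eq, MvPolynomial.algebraMap_eq,
        map_mul, map_neg, map_sub]
      simp only [Fin.mk_one]
      linear_combination (𝐲 - MvPolynomial.C c') * hC

lemma one_mem_Aff [IsDomain R] : (1 : GA 2 R) ∈ Aff 2 R :=
  mem_Aff_iff.2 ⟨⟨1, 0, 0, by simp [lin_eq]⟩, ⟨0, 1, 0, by simp [lin_eq]⟩⟩

lemma mul_mem_Aff [IsDomain R] {σ τ : GA 2 R} (hσ : σ ∈ Aff 2 R) (hτ : τ ∈ Aff 2 R) :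
    σ * τ ∈ Aff 2 R := by
  rw [mem_Aff_iff] at hσ hτ ⊢
  obtain ⟨⟨a, b, c, h0⟩, ⟨a', b', c', h1⟩⟩ := hσ
  have key : ∀ i j k, ∃ i' j' k', σ (lin i j k) = lin i' j' k' := fun i j k =>
    ⟨i * a + j * a', i * b + j * b', i * c + j * c' + k, by
      rw [GA_lin, h0, h1]; simp only [lin_eq, map_add, map_mul]; ring⟩
  obtain ⟨⟨d, e, f, h2⟩, ⟨d', e', f', h3⟩⟩ := hτ
  rw [AlgEquiv.mul_apply, AlgEquiv.mul_apply, h2, h3]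
  exact ⟨key _ _ _, key _ _ _⟩

lemma inv_mem_Aff [IsDomain R] {σ : GA 2 R} (hσ : σ ∈ Aff 2 R) : σ⁻¹ ∈ Aff 2 R := by
  rw [mem_Aff_iff] at hσ ⊢
  obtain ⟨⟨a, b, c, h0⟩, ⟨a', b', c', h1⟩⟩ := hσ
  obtain ⟨u, hu⟩ := exists_det_unit h0 h1
  have h2 := lin_comp_lin hu (h0.trans (lin_eq' a b c)) (h1.trans (lin_eq' a' b' c'))
  exact ⟨⟨_, _, _, GA_inv_apply_eq.2 (h2.1.symm.trans (GA_lin σ _ _ _).symm)⟩,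
    ⟨_, _, _, GA_inv_apply_eq.2 (h2.2.symm.trans (GA_lin σ _ _ _).symm)⟩⟩

/-- Over a domain, an automorphism is triangular as soon as `y` is mapped to `R^* y + R`. -/
lemma mem_BA_iff [IsDomain R] {σ : GA 2 R} :
    σ ∈ BA 2 R ↔ ∃ (v : Rˣ) (w : R), σ 𝐲 = MvPolynomial.C (v : R) * 𝐲 + MvPolynomial.C w := by
  constructor
  · intro h
    obtain ⟨v, g, hg, h1⟩ := h 1
    have he : {j : Fin 2 | 1 < j} = ∅ := by
      ext j; fin_cases j <;> simp
    rw [he, MvPolynomial.supported_empty, Algebra.mem_bot] at hg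
    obtain ⟨w, rfl⟩ := hg
    exact ⟨v, w, h1⟩
  · rintro ⟨v, w, h⟩ i
    obtain ⟨u, g, hg⟩ := exists_eq_tri (scaleY_inv_apply_y v w 𝐲 σ h)
    rw [mul_inv_eq_iff_eq_mul] at hg
    fin_cases i
    · refine ⟨u, aeval 𝐲 g, ?_, by simp [hg, lenOne]⟩
      have hy : (𝐲 : MvPolynomial (Fin 2) R) ∈
          MvPolynomial.supported R {j : Fin 2 | 0 < j} :=
        Algebra.subset_adjoin ⟨1, by simp, rfl⟩
      exact Algebra.adjoin_le (Set.singleton_subset_iff.2 hy)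
        (Polynomial.aeval_mem_adjoin_singleton R _)
    · exact ⟨v, MvPolynomial.C w, Subalgebra.algebraMap_mem _ w, h⟩

lemma exists_lenOne_of_mem_BA [IsDomain R] {σ : GA 2 R} (h : σ ∈ BA 2 R) :
    ∃ (u : Rˣ) (g : R[X]), σ 𝐱 = lenOne (u : R) g := by
  obtain ⟨v, w, h⟩ := mem_BA_iff.1 h
  obtain ⟨u, g, hg⟩ := exists_eq_tri (scaleY_inv_apply_y v w 𝐲 σ h)
  rw [mul_inv_eq_iff_eq_mul] at hg
  exact ⟨u, g, by simp [hg]⟩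

lemma mul_mem_BA [IsDomain R] {σ τ : GA 2 R} (hσ : σ ∈ BA 2 R) (hτ : τ ∈ BA 2 R) :
    σ * τ ∈ BA 2 R := by
  obtain ⟨v, w, h⟩ := mem_BA_iff.1 hσ
  obtain ⟨v', w', h'⟩ := mem_BA_iff.1 hτ
  refine mem_BA_iff.2 ⟨v' * v, v' * w + w', ?_⟩
  rw [AlgEquiv.mul_apply, h', map_add, map_mul, GA_apply_C, GA_apply_C, h]
  simp only [Units.val_mul, map_mul, map_add]
  ring

lemma inv_mem_BA [IsDomain R] {σ : GA 2 R} (hσ : σ ∈ BA 2 R) : σ⁻¹ ∈ BA 2 R := by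
  obtain ⟨v, w, h⟩ := mem_BA_iff.1 hσ
  refine mem_BA_iff.2 ⟨v⁻¹, -((v⁻¹ : Rˣ) * w), GA_inv_apply_eq.2 ?_⟩
  have hv : MvPolynomial.C (σ := Fin 2) ((v⁻¹ : Rˣ) : R) * MvPolynomial.C (v : R) = 1 := by
    rw [← map_mul]; simp
  rw [map_add, map_mul, GA_apply_C, GA_apply_C, h, map_neg, map_mul]
  linear_combination -𝐲 * hv

lemma tri_mem_BA [IsDomain R] (u : Rˣ) (g : R[X]) : tri u g ∈ BA 2 R :=
  mem_BA_iff.2 ⟨1, 0, by simp⟩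

/-- The image of an affine polynomial under a triangular automorphism. -/
lemma BA_lin [IsDomain R] {T : GA 2 R} (hT : T ∈ BA 2 R) :
    ∃ u : Rˣ, ∀ a b c, ∃ P, T (lin a b c) = lenOne (a * u) P := by
  obtain ⟨v, w, h⟩ := mem_BA_iff.1 hT
  obtain ⟨u, g, hg⟩ := exists_lenOne_of_mem_BA hT
  refine ⟨u, fun a b c => ⟨C a * g + C (b * v) * X + C (b * w + c), ?_⟩⟩
  rw [GA_lin, h, hg]
  simp only [lenOne, map_add, map_mul, aeval_C, aeval_X, MvPolynomial.algebraMap_eq]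
  ring

/-- The determinant is the product of the diagonal entries, so b is a unit. -/
lemma mem_BA_of_lin [IsDomain R] {σ : GA 2 R} (hσ : σ ∈ Aff 2 R) {b c : R}
    (h : σ 𝐲 = lin 0 b c) : σ ∈ BA 2 R := by
  obtain ⟨⟨a, b', c', h0⟩, -⟩ := mem_Aff_iff.1 hσ
  obtain ⟨u, hu⟩ := exists_det_unit h0 h
  rw [mul_zero, sub_zero] at hu
  obtain ⟨v, rfl⟩ : IsUnit b := isUnit_of_mul_isUnit_right (hu ▸ u.isUnit)
  exact mem_BA_iff.2 ⟨v, c, by simp [h, lin_eq]⟩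

lemma two_le_natDegree_of_notMem_Aff [IsDomain R] {t : GA 2 R} (ht : t ∈ BA 2 R)
    (hta : t ∉ Aff 2 R) {u : R} {g : R[X]} (h : t 𝐱 = lenOne u g) : 2 ≤ g.natDegree := by
  by_contra hlt
  obtain ⟨v, w, hvw⟩ := mem_BA_iff.1 ht
  refine hta (mem_Aff_iff.2 ⟨⟨u, g.coeff 1, g.coeff 0, ?_⟩, ⟨0, v, w, by simp [hvw, lin_eq]⟩⟩)
  rw [h, lin, ← Polynomial.eq_X_add_C_of_natDegree_le_one (by omega)]

end Affine

/-! ### Degree-increasing normal forms of tame automorphisms. -/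

section NormalForm

variable {R : Type*} [CommRing R]

/-- Normal forms of tame automorphisms: alternating products of affine and non-affine triangular
automorphisms for which every triangular factor raises the degree. -/
inductive NormalForm : GA 2 R → Prop
  | aff {a : GA 2 R} (ha : a ∈ Aff 2 R) : NormalForm a
  | step {ρ t a : GA 2 R} (hρ : NormalForm ρ)
      (hdeg : (ρ 𝐱).totalDegree ≤ (ρ 𝐲).totalDegree)
      (ht : t ∈ BA 2 R) (hta : t ∉ Aff 2 R) (ha : a ∈ Aff 2 R) : NormalForm (ρ * t * a)

lemma one_le_totalDegree_lenOne {p : R} (hp : p ≠ 0) (Q : R[X]) :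
    1 ≤ (lenOne p Q).totalDegree := by
  have h := natDegree_subst_le (a := X) (b := 0) natDegree_X_le (by simp) (lenOne p Q)
  rw [subst_lenOne, ← C_0, Polynomial.comp_C, Polynomial.natDegree_linear hp] at h
  exact h

lemma natDegree_le_totalDegree_lenOne (p : R) (Q : R[X]) :
    Q.natDegree ≤ (lenOne p Q).totalDegree := by
  have h := natDegree_subst_le (a := 0) (b := X) (by simp) natDegree_X_le (lenOne p Q)
  rwa [subst_lenOne, mul_zero, zero_add, Polynomial.comp_X] at h

lemma totalDegree_GA_lin_le {η : GA 2 R} (h : (η 𝐲).totalDegree ≤ (η 𝐱).totalDegree)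
    (a b c : R) : (η (lin a b c)).totalDegree ≤ (η 𝐱).totalDegree := by
  rw [GA_lin]
  refine (MvPolynomial.totalDegree_add _ _).trans (max_le ?_ (by simp))
  refine (MvPolynomial.totalDegree_add _ _).trans (max_le (totalDegree_C_mul_le _ _) ?_)
  exact (totalDegree_C_mul_le _ _).trans h

lemma mem_TA_of_Aff {a : GA 2 R} (h : a ∈ Aff 2 R) : a ∈ TA 2 R :=
  Subgroup.subset_closure (Or.inl h)

lemma mem_TA_of_BA {a : GA 2 R} (h : a ∈ BA 2 R) : a ∈ TA 2 R :=
  Subgroup.subset_closure (Or.inr h)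

lemma NormalForm.mem_TA {ρ : GA 2 R} (h : NormalForm ρ) : ρ ∈ TA 2 R := by
  induction h with
  | aff h => exact mem_TA_of_Aff h
  | step _ _ ht _ ha ih => exact mul_mem (mul_mem ih (mem_TA_of_BA ht)) (mem_TA_of_Aff ha)

variable [IsDomain R]

lemma totalDegree_C_mul_add_C {c : R} (hc : c ≠ 0) {P : MvPolynomial (Fin 2) R}
    (hP : 1 ≤ P.totalDegree) (w : R) :
    (MvPolynomial.C c * P + MvPolynomial.C w).totalDegree = P.totalDegree := by
  rw [MvPolynomial.totalDegree_add_eq_left_of_totalDegree_lt, totalDegree_C_mul_of_ne_zero hc]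
  rw [totalDegree_C_mul_of_ne_zero hc, MvPolynomial.totalDegree_C]
  exact hP

lemma totalDegree_mul_BA_y (ρ : GA 2 R) {t : GA 2 R} (ht : t ∈ BA 2 R) :
    ((ρ * t) 𝐲).totalDegree = (ρ 𝐲).totalDegree := by
  obtain ⟨v, w, h⟩ := mem_BA_iff.1 ht
  rw [AlgEquiv.mul_apply, h, map_add, map_mul, GA_apply_C, GA_apply_C,
    totalDegree_C_mul_add_C v.ne_zero (one_le_totalDegree_GA ρ 1)]

/-- A non-affine t sends x to u x + g(y) with deg g ≥ 2, so g(ρ(y)) dominates u ρ(x). -/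
lemma lt_totalDegree_mul_BA_x {ρ t : GA 2 R}
    (hdeg : (ρ 𝐱).totalDegree ≤ (ρ 𝐲).totalDegree) (ht : t ∈ BA 2 R) (hta : t ∉ Aff 2 R) :
    (ρ 𝐲).totalDegree < ((ρ * t) 𝐱).totalDegree := by
  obtain ⟨u, g, hg⟩ := exists_lenOne_of_mem_BA ht
  have h2 := two_le_natDegree_of_notMem_Aff ht hta hg
  have hy := one_le_totalDegree_GA ρ 1
  have h1 := totalDegree_aeval hy g
  have h3 : 2 * (ρ 𝐲).totalDegree ≤ g.natDegree * (ρ 𝐲).totalDegree := Nat.mul_le_mul_right _ h2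
  rw [AlgEquiv.mul_apply, hg, GA_lenOne,
    MvPolynomial.totalDegree_add_eq_right_of_totalDegree_lt]
  · omega
  · rw [totalDegree_C_mul_of_ne_zero u.ne_zero]; omega

lemma totalDegree_GA_lin {η : GA 2 R} (h : (η 𝐲).totalDegree < (η 𝐱).totalDegree)
    {a : R} (ha : a ≠ 0) (b c : R) : (η (lin a b c)).totalDegree = (η 𝐱).totalDegree := by
  rw [GA_lin, add_assoc, MvPolynomial.totalDegree_add_eq_left_of_totalDegree_lt,
    totalDegree_C_mul_of_ne_zero ha]
  rw [totalDegree_C_mul_of_ne_zero ha]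
  refine (MvPolynomial.totalDegree_add _ _).trans_lt (max_lt ?_ ?_)
  · exact (totalDegree_C_mul_le _ _).trans_lt h
  · rw [MvPolynomial.totalDegree_C]; exact one_le_totalDegree_GA η 0

lemma NormalForm.mul_Aff {ρ a : GA 2 R} (hρ : NormalForm ρ) (ha : a ∈ Aff 2 R) :
    NormalForm (ρ * a) := by
  cases hρ with
  | aff h => exact .aff (mul_mem_Aff h ha)
  | step hρ hdeg ht hta ha' =>
    rw [mul_assoc]
    exact .step hρ hdeg ht hta (mul_mem_Aff ha' ha)

/-- Let the last affine factor a send y to m x + m'y + w. If m = 0, then a is triangular and t'at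
merges into one triangular factor. If m ≠ 0, the second component has the largest degree, so t can
be appended as a new step. -/
lemma NormalForm.mul_BA {ρ t : GA 2 R} (hρ : NormalForm ρ) (ht : t ∈ BA 2 R) :
    NormalForm (ρ * t) := by
  by_cases hta : t ∈ Aff 2 R
  · exact hρ.mul_Aff hta
  have hρ' := hρ
  cases hρ with
  | aff h =>
    have := NormalForm.step (.aff h) (by rw [h 0, h 1]) ht hta one_mem_Aff
    rwa [mul_one] at this
  | @step ρ t' a hρ hdeg ht' hta' ha =>
    obtain ⟨⟨α, β, γ, hax⟩, ⟨m, m', w, hay⟩⟩ := mem_Aff_iff.1 ha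
    by_cases hm : m = 0
    · subst hm
      have hT : t' * a * t ∈ BA 2 R := mul_mem_BA (mul_mem_BA ht' (mem_BA_of_lin ha hay)) ht
      have he : ρ * t' * a * t = ρ * (t' * a * t) := by simp only [mul_assoc]
      rw [he]
      by_cases hTa : t' * a * t ∈ Aff 2 R
      · exact hρ.mul_Aff hTa
      · have := NormalForm.step hρ hdeg hT hTa one_mem_Aff
        rwa [mul_one] at this
    · have hlt : ((ρ * t') 𝐲).totalDegree < ((ρ * t') 𝐱).totalDegree := by
        rw [totalDegree_mul_BA_y ρ ht']; exact lt_totalDegree_mul_BA_x hdeg ht' hta'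
      have := NormalForm.step hρ' (by
        rw [AlgEquiv.mul_apply, AlgEquiv.mul_apply (ρ * t'), hax, hay,
          totalDegree_GA_lin hlt hm]
        exact totalDegree_GA_lin_le hlt.le _ _ _) ht hta one_mem_Aff
      rwa [mul_one] at this

lemma normalForm_of_mem_TA {ρ : GA 2 R} (h : ρ ∈ TA 2 R) : NormalForm ρ := by
  induction h using Subgroup.closure_induction_right with
  | one => exact .aff one_mem_Aff
  | mul_right x _ y hy ih => exact hy.elim ih.mul_Aff ih.mul_BA
  | mul_inv_cancel x _ y hy ih =>
    exact hy.elim (fun h => ih.mul_Aff (inv_mem_Aff h)) (fun h => ih.mul_BA (inv_mem_BA h))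

/-- A tame coordinate of degree at least two is an affine function of a tame pair whose second
component has smaller degree. -/
lemma NormalForm.exists_reduction {ρ : GA 2 R} (h : NormalForm ρ)
    (hd : 2 ≤ (ρ 𝐲).totalDegree) :
    ∃ η ∈ TA 2 R, ∃ a ∈ Aff 2 R, ∃ m m' w : R, m ≠ 0 ∧ a 𝐲 = lin m m' w ∧ ρ 𝐲 = η (a 𝐲) ∧
      (η 𝐲).totalDegree < (ρ 𝐲).totalDegree := by
  induction h with
  | aff h => rw [h 1] at hd; omega
  | @step ρ t a hρ hdeg ht hta ha ih =>
    obtain ⟨-, ⟨m, m', w, hay⟩⟩ := mem_Aff_iff.1 ha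
    -- If m = 0, the last step changes the second component only by an R-affine map, and the shorter
    -- word is used. Otherwise ρt has a second component of smaller degree than its first, and a(y)
    -- involves x.
    by_cases hm : m = 0
    · subst hm
      have hT := mul_mem_BA ht (mem_BA_of_lin ha hay)
      rw [mul_assoc, totalDegree_mul_BA_y ρ hT] at hd ⊢
      obtain ⟨η, hη, b, hb, m, m', w, hm, hby, hρy, hlt⟩ := ih hd
      obtain ⟨v, w', hvw⟩ := mem_BA_iff.1 hT
      have hs : (b * scaleY v w') 𝐲 = lin (v * m) (v * m') (v * w + w') := by
        rw [AlgEquiv.mul_apply, scaleY_y, map_add, map_mul, GA_apply_C, GA_apply_C, hby]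
        simp only [lin_eq, map_mul, map_add]; ring
      have hsA : scaleY v w' ∈ Aff 2 R :=
        mem_Aff_iff.2 ⟨⟨1, 0, 0, by simp [lin_eq]⟩, ⟨0, v, w', by simp [lin_eq]⟩⟩
      refine ⟨η, hη, _, mul_mem_Aff hb hsA, _, _, _, mul_ne_zero v.ne_zero hm, hs, ?_, hlt⟩
      rw [AlgEquiv.mul_apply, hvw, AlgEquiv.mul_apply, scaleY_y]
      simp only [map_add, map_mul, GA_apply_C, hρy]
    · have hlt := lt_totalDegree_mul_BA_x hdeg ht hta
      refine ⟨ρ * t, mul_mem hρ.mem_TA (mem_TA_of_BA ht), a, ha, m, m', w, hm, hay, rfl, ?_⟩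
      rw [← totalDegree_mul_BA_y ρ ht] at hlt
      rw [AlgEquiv.mul_apply (ρ * t), hay, totalDegree_GA_lin hlt hm]
      exact hlt

end NormalForm

/-! ### Tame coordinates and pairs of length-one polynomials. -/

section Tame

variable {R K : Type*} [CommRing R] [Field K] [Algebra R K] [IsFractionRing R K]

/-- Comparison of a low-degree mate over `R` with one over `K`. -/
lemma map_eq_of_totalDegree_lt {η : GA 2 R} {m m' w : R} (hm : m ≠ 0)
    {F : MvPolynomial (Fin 2) R} (hF : F = η (lin m m' w))
    (hη : (η 𝐲).totalDegree < F.totalDegree) {Ψ : GA 2 K}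
    (hΨ : Ψ 𝐲 = MvPolynomial.map (algebraMap R K) F)
    (hdeg : (Ψ 𝐱).totalDegree < F.totalDegree) :
    ∃ c s : K, MvPolynomial.map (algebraMap R K) (η 𝐲) =
      MvPolynomial.C c * Ψ 𝐱 + MvPolynomial.C s := by
  have hinj := IsFractionRing.injective R K
  have hm' : algebraMap R K m ≠ 0 := (map_ne_zero_iff _ hinj).2 hm
  -- As m is invertible in K, (η(y), F) is an automorphism over K.
  obtain ⟨u, k, hk⟩ := mate_eq (σ := baseChange (algebraMap R K) η *
      lenOneGA hm' (C (algebraMap R K m') * X + C (algebraMap R K w))) (τ := Ψ) (by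
    rw [hΨ, hF, ← baseChange_map, lin, map_lenOne]
    simp)
  rw [AlgEquiv.mul_apply, lenOneGA_x, baseChange_X, hΨ] at hk
  -- For nonconstant k, k(F) would have degree at least deg F, above both mates.
  have hk0 : k.natDegree = 0 := by
    by_contra hne
    have hk1 : 1 ≤ k.natDegree := Nat.one_le_iff_ne_zero.2 hne
    have hFd := totalDegree_map_of_injective hinj F
    have h1 := totalDegree_aeval (P := MvPolynomial.map (algebraMap R K) F) (by omega) k
    have h2 : 1 * F.totalDegree ≤ k.natDegree * F.totalDegree := Nat.mul_le_mul_right _ hk1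
    have h3 := congrArg MvPolynomial.totalDegree hk
    rw [totalDegree_map_of_injective hinj,
      MvPolynomial.totalDegree_add_eq_right_of_totalDegree_lt] at h3
    · rw [h1, hFd] at h3; omega
    · rw [totalDegree_C_mul_of_ne_zero u.ne_zero, h1, hFd]; omega
  rw [Polynomial.eq_C_of_natDegree_eq_zero hk0, aeval_C] at hk
  exact ⟨_, _, hk⟩

lemma totalDegree_length2Poly {p₁ : K} (p₂ : K) (hp₁ : p₁ ≠ 0) (Q₁ : K[X]) {Q₂ : K[X]}
    (hn : 2 ≤ Q₂.natDegree) : (length2Poly p₁ p₂ Q₁ Q₂).totalDegree =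
      Q₂.natDegree * (lenOne p₁ Q₁).totalDegree := by
  have h1 := one_le_totalDegree_lenOne hp₁ Q₁
  have h2 := totalDegree_aeval h1 Q₂
  have h3 : 2 * 1 ≤ Q₂.natDegree * (lenOne p₁ Q₁).totalDegree := Nat.mul_le_mul hn h1
  have h4 : (MvPolynomial.C p₂ * 𝐲 : MvPolynomial (Fin 2) K).totalDegree ≤ 1 :=
    (totalDegree_C_mul_le _ _).trans (by simp)
  rw [length2Poly_eq, MvPolynomial.totalDegree_add_eq_right_of_totalDegree_lt, h2]
  omega

variable [IsDomain R]

/-- A tame coordinate `p x + Q(y)` has a mate of the form `α x + P(y)`. -/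
lemma exists_lenOne_mate_of_tame {p : R} (hp : p ≠ 0) {Q : R[X]} {ρ : GA 2 R} (hρ : ρ ∈ TA 2 R)
    (hρy : ρ 𝐲 = lenOne p Q) :
    ∃ (σ : GA 2 R) (α : R) (P : R[X]), σ 𝐲 = lenOne p Q ∧ σ 𝐱 = lenOne α P := by
  have hinj := IsFractionRing.injective R (FractionRing R)
  by_cases hQ : Q.natDegree ≤ 1
  · obtain ⟨u, hu⟩ := jacobian_eq_C ρ
    have hlin : lenOne p Q = lin p (Q.coeff 1) (Q.coeff 0) := by
      rw [lin, ← Polynomial.eq_X_add_C_of_natDegree_le_one hQ]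
    rw [hρy, hlin] at hu
    have h1 := congrArg MvPolynomial.constantCoeff hu
    -- The linear part of ρ(x) completes that of p x + Q(y) to a matrix of unit determinant, even if
    -- ρ(x) is not affine.
    simp only [jacobian, lin_eq, map_add, MvPolynomial.pderiv_C_mul, MvPolynomial.pderiv_X_self,
      MvPolynomial.pderiv_C, MvPolynomial.pderiv_X_of_ne (show (1 : Fin 2) ≠ 0 by decide),
      MvPolynomial.pderiv_X_of_ne (show (0 : Fin 2) ≠ 1 by decide), map_sub, map_mul,
      MvPolynomial.constantCoeff_C, mul_one, mul_zero, zero_add,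
      add_zero] at h1
    obtain ⟨σ, hx, hy⟩ := exists_GA_lin (c := 0) (c' := Q.coeff 0) h1
    exact ⟨σ, _, _, hy.trans hlin.symm, hx⟩
  · have hd := natDegree_le_totalDegree_lenOne p Q
    obtain ⟨η, -, a, ha, m, m', w, hm, hay, hη, hlt⟩ :=
      (normalForm_of_mem_TA hρ).exists_reduction (by rw [hρy]; omega)
    have hp' : algebraMap R (FractionRing R) p ≠ 0 := (map_ne_zero_iff _ hinj).2 hp
    rw [hρy] at hη hlt
    -- Over K the mate y has smaller degree, so η(y) is affine in y. Hence η is triangular and η ∘ a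
    -- has length-one components.
    obtain ⟨c, s, hcs⟩ := map_eq_of_totalDegree_lt hm (hη.trans (by rw [hay])) hlt
      (Ψ := lenOneGA hp' (Q.map (algebraMap R (FractionRing R)))) (by rw [lenOneGA_y, map_lenOne])
      (by rw [lenOneGA_x, MvPolynomial.totalDegree_X]; omega)
    rw [lenOneGA_x] at hcs
    have hcs' : MvPolynomial.map (algebraMap R (FractionRing R)) (η 𝐲) = lenOne 0 (C c * X + C s) := by
      rw [hcs]; simp [lenOne, MvPolynomial.algebraMap_eq]
    obtain ⟨p', Q', hηy, hp'0, hQ'⟩ := exists_lenOne_of_map hinj hcs'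
    have hp'0 : p' = 0 := (map_eq_zero_iff _ hinj).1 hp'0
    have hQ'd : Q'.natDegree ≤ 1 := by
      rw [← Polynomial.natDegree_map_eq_of_injective hinj, hQ']
      exact Polynomial.natDegree_linear_le
    have hηy' : η 𝐲 = MvPolynomial.C (Q'.coeff 1) * 𝐲 + MvPolynomial.C (Q'.coeff 0) := by
      rw [hηy, hp'0, Polynomial.eq_X_add_C_of_natDegree_le_one hQ'd]
      simp [lenOne, MvPolynomial.algebraMap_eq]
    obtain ⟨v, hv⟩ := isUnit_of_coordinate ⟨η, rfl⟩ hηy'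
    obtain ⟨⟨i, j, k, hax⟩, -⟩ := mem_Aff_iff.1 ha
    obtain ⟨u, hu⟩ := BA_lin (mem_BA_iff.2 ⟨v, _, by rw [hv]; exact hηy'⟩)
    obtain ⟨P, hP⟩ := hu i j k
    exact ⟨η * a, _, P, hη.symm, by rw [AlgEquiv.mul_apply, hax, hP]⟩

/-- Adding a multiple of the second component makes the first one of length one. -/
lemma exists_mul_tri_mem_B1 {σ : GA 2 R} {α β : R} {P Q : R[X]} (hβ : β ≠ 0)
    (hx : σ 𝐱 = lenOne α P) (hy : σ 𝐲 = lenOne β Q) :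
    ∃ g : R[X], (σ * tri 1 g) 𝐱 ∈ B1 R ∧ (σ * tri 1 g) 𝐲 ∈ B1 R := by
  have h : ∀ k : R, (σ * tri 1 (C k * X) : GA 2 R) 𝐱 = lenOne (α + k * β) (P + C k * Q) := by
    intro k
    rw [AlgEquiv.mul_apply, tri_x, GA_lenOne, hx, hy]
    simp only [lenOne, map_mul, map_add, aeval_C, aeval_X, MvPolynomial.algebraMap_eq,
      Units.val_one, map_one]
    ring
  have h' : ∀ g, (σ * tri 1 g : GA 2 R) 𝐲 ∈ B1 R := by
    intro g
    rw [AlgEquiv.mul_apply, tri_y, hy]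
    exact lenOne_mem_B1 hβ Q
  -- Only a zero coefficient of x needs repair: adding the second component once replaces α = 0 by
  -- β.
  by_cases hα : α = 0
  · exact ⟨_, h 1 ▸ lenOne_mem_B1 (by simpa [hα]) _, h' _⟩
  · exact ⟨_, h 0 ▸ lenOne_mem_B1 (by simpa) _, h' _⟩

/-- The reduction gives F = η(a(y)) with η(y) R-affine in f. So f is tame and has a pair σ with σ(y)
= f, σ(x) = αx + P(y). Then T = σ⁻¹η is triangular and F = σ(Ta(y)); T∘a has length-one components
up to zero coefficients of x, which triangular factors repair. -/
lemma exists_B1_pairs_of_tame [UniqueFactorizationMonoid R]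
    {p₁ : R} {p₂ : K} {Q₁ : R[X]} {Q₂ : K[X]} {F : MvPolynomial (Fin 2) R}
    (hp₁ : p₁ ≠ 0) (hp₂ : p₂ ≠ 0)
    (hQ₁ : Q₁.eval 0 = 0) (hgcd : IsRelPrime (C p₁) Q₁) (hn : 2 ≤ Q₂.natDegree)
    (hF : MvPolynomial.map (algebraMap R K) F =
      length2Poly (algebraMap R K p₁) p₂ (Q₁.map (algebraMap R K)) Q₂)
    (h : IsTame F) : ∃ σ τ : GA 2 R,
      σ 𝐱 ∈ B1 R ∧ σ 𝐲 ∈ B1 R ∧ τ 𝐱 ∈ B1 R ∧ τ 𝐲 ∈ B1 R ∧ (σ * τ) 𝐲 = F := by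
  obtain ⟨ρ, hρ, hρy⟩ := h
  have hinj := IsFractionRing.injective R K
  have hp₁' : algebraMap R K p₁ ≠ 0 := (map_ne_zero_iff _ hinj).2 hp₁
  have hFd : F.totalDegree = Q₂.natDegree * (lenOne p₁ Q₁).totalDegree := by
    rw [← totalDegree_map_of_injective hinj, hF, totalDegree_length2Poly p₂ hp₁' _ hn,
      ← map_lenOne, totalDegree_map_of_injective hinj]
  have hf := one_le_totalDegree_lenOne hp₁ Q₁
  have hFd2 : 2 * (lenOne p₁ Q₁).totalDegree ≤ F.totalDegree :=
    hFd ▸ Nat.mul_le_mul_right _ hn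
  obtain ⟨η, hη, a, ha, m, m', w, hm, hay, hFη, hlt⟩ :=
    (normalForm_of_mem_TA hρ).exists_reduction (by rw [hρy]; omega)
  rw [hρy] at hFη hlt
  obtain ⟨c, s, hcs⟩ := map_eq_of_totalDegree_lt hm (hFη.trans (by rw [hay])) hlt
    (Ψ := length2GA hp₁' hp₂ (Q₁.map (algebraMap R K)) Q₂) (by rw [length2GA_y, hF])
    (by rw [length2GA_x, ← map_lenOne, totalDegree_map_of_injective hinj]; omega)
  rw [length2GA_x, ← map_lenOne] at hcs
  obtain ⟨u, e, hηy⟩ := coordinate_eq_of_map ⟨η, rfl⟩ hQ₁ hgcd hcs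
  obtain ⟨σ, α, P, hσy, hσx⟩ := exists_lenOne_mate_of_tame hp₁
    (mul_mem hη (inv_mem (mem_TA_of_BA (mem_BA_iff.2 ⟨u, e, scaleY_y u e⟩))))
    (scaleY_inv_apply_y u e _ η hηy)
  have hT : σ⁻¹ * η ∈ BA 2 R := by
    refine mem_BA_iff.2 ⟨u, e, ?_⟩
    rw [AlgEquiv.mul_apply, hηy, ← hσy]
    simp
  obtain ⟨g, hgx, hgy⟩ := exists_mul_tri_mem_B1 hp₁ hσx hσy
  obtain ⟨v, hv⟩ := BA_lin (mul_mem_BA (inv_mem_BA (tri_mem_BA 1 g)) hT)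
  obtain ⟨⟨i, j, k, hax⟩, -⟩ := mem_Aff_iff.1 ha
  obtain ⟨A, hA⟩ := hv i j k
  obtain ⟨B, hB⟩ := hv m m' w
  obtain ⟨g', hgx', hgy'⟩ := exists_mul_tri_mem_B1
    (σ := (tri 1 g)⁻¹ * (σ⁻¹ * η) * a) (mul_ne_zero hm v.ne_zero)
    (by rw [AlgEquiv.mul_apply, hax, hA]) (by rw [AlgEquiv.mul_apply, hay, hB])
  refine ⟨_, _, hgx, hgy, hgx', hgy', ?_⟩
  have : σ * tri 1 g * ((tri 1 g)⁻¹ * (σ⁻¹ * η) * a * tri 1 g') = η * a * tri 1 g' := by group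
  rw [this, AlgEquiv.mul_apply, tri_y, AlgEquiv.mul_apply, ← hFη]

/-- An automorphism with both components of length one is tame. -/
lemma mem_TA_of_mem_B1 {σ : GA 2 R} (hx : σ 𝐱 ∈ B1 R) (hy : σ 𝐲 ∈ B1 R) : σ ∈ TA 2 R := by
  obtain ⟨a, P, ha, hx⟩ := exists_lenOne_of_mem_B1 hx
  obtain ⟨b, Q, hb, hy⟩ := exists_lenOne_of_mem_B1 hy
  have hinj := IsFractionRing.injective R (FractionRing R)
  set φ := algebraMap R (FractionRing R)
  have ha' : φ a ≠ 0 := (map_ne_zero_iff _ hinj).2 ha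
  obtain ⟨c, g, hg⟩ := mate_eq (σ := baseChange φ (σ * swap))
    (τ := lenOneGA ha' (P.map φ)) (by simp [hx, map_lenOne])
  rw [baseChange_X, AlgEquiv.mul_apply, swap_x, hy, lenOneGA_x, lenOneGA_y, map_lenOne] at hg
  have hq : ∀ S : (FractionRing R)[X], S.comp 0 = C (S.eval 0) := fun S => by
    rw [← C_0, Polynomial.comp_C]
  -- At y = 0 both components are of degree at most 1 in x, the first exactly 1.
  have hg1 : g.natDegree ≤ 1 := by
    have h1 := congrArg (subst X 0) hg
    rw [map_add, map_mul, subst_aeval, subst_lenOne, subst_lenOne, subst_y, mul_zero, zero_add,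
      hq, hq] at h1
    have h2 := congrArg natDegree h1
    rw [Polynomial.natDegree_comp, Polynomial.natDegree_linear ha', mul_one] at h2
    rw [← h2]
    exact Polynomial.natDegree_linear_le
  rw [Polynomial.eq_X_add_C_of_natDegree_le_one hg1] at hg
  have hg2 : lenOne (φ b) (Q.map φ) = lenOne (g.coeff 1 * φ a)
      (C (g.coeff 1) * P.map φ + C (c : FractionRing R) * X + C (g.coeff 0)) := by
    rw [hg]
    simp only [lenOne, map_add, map_mul, aeval_C, aeval_X, MvPolynomial.algebraMap_eq]
    ring
  obtain ⟨hb', hQ'⟩ := lenOne_inj hg2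
  -- W(y) = aσ(y) - bσ(x) eliminates x. It is affine by the relation over the fraction field, and
  -- its derivative is the Jacobian of σ, so its leading coefficient is the unit u.
  set W := C a * Q - C b * P with hW
  have hWd : W.natDegree ≤ 1 := by
    rw [← Polynomial.natDegree_map_eq_of_injective hinj]
    have : W.map φ = C (φ a * c) * X + C (φ a * g.coeff 0) := by
      simp only [hW, Polynomial.map_sub, Polynomial.map_mul, Polynomial.map_C, hQ', hb', C_mul]
      ring
    exact this ▸ Polynomial.natDegree_linear_le
  have hWl := Polynomial.eq_X_add_C_of_natDegree_le_one hWd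
  obtain ⟨u, hu⟩ := jacobian_eq_C σ
  have hWu : W.coeff 1 = u := by
    have h1 : jacobian (σ 𝐱) (σ 𝐲) = aeval 𝐲 (derivative W) := by
      simp only [hx, hy, jacobian, pderiv_zero_lenOne, pderiv_one_lenOne, hW,
        derivative_C_mul, map_sub, map_mul, aeval_C, MvPolynomial.algebraMap_eq]
      ring
    rw [hWl] at h1
    have h2 := h1.symm.trans hu
    simp [MvPolynomial.algebraMap_eq] at h2
    exact h2
  have hdet : a * Q.coeff 1 - P.coeff 1 * b = u := by
    rw [← hWu, hW]; simp [mul_comm]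
  obtain ⟨l, hlx, hly⟩ := exists_GA_lin (c := 0) (c' := 0) hdet
  have hl : l ∈ Aff 2 R := mem_Aff_iff.2 ⟨⟨_, _, _, hlx⟩, ⟨_, _, _, hly⟩⟩
  have hu1 : MvPolynomial.C (σ := Fin 2) ((u⁻¹ : Rˣ) : R) * MvPolynomial.C (u : R) = 1 := by
    rw [← map_mul]; simp
  have hly' : l⁻¹ 𝐲 = lin (-(u⁻¹ * b)) (u⁻¹ * a) 0 := by
    rw [GA_inv_apply_eq, GA_lin, hlx, hly]
    rw [← hdet] at hu1
    simp only [lin_eq, map_neg, map_mul, map_zero, map_sub] at hu1 ⊢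
    linear_combination -𝐲 * hu1
  -- Removing the linear part l of σ sends y to u⁻¹W(y), which is y plus a constant.
  have hT : σ * l⁻¹ ∈ BA 2 R := by
    refine mem_BA_iff.2 ⟨1, u⁻¹ * W.coeff 0, ?_⟩
    rw [AlgEquiv.mul_apply, hly', GA_lin, hx, hy]
    have h1 := congrArg (aeval (𝐲 : MvPolynomial (Fin 2) R)) hWl
    rw [hWu, hW] at h1
    simp only [map_add, map_sub, map_mul, aeval_C, aeval_X, MvPolynomial.algebraMap_eq] at h1
    rw [← hW] at h1
    simp only [lenOne, map_neg, map_mul, map_zero, Units.val_one, map_one]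
    linear_combination MvPolynomial.C ((u⁻¹ : Rˣ) : R) * h1 + 𝐲 * hu1
  have := mul_mem (mem_TA_of_BA hT) (mem_TA_of_Aff hl)
  rwa [inv_mul_cancel_right] at this

end Tame

end LengthTwo

end

/-! ### The main theorem. -/

theorem theoremP5 {R K : Type*} [CommRing R] [IsDomain R] [UniqueFactorizationMonoid R]
    [Field K] [Algebra R K] [IsFractionRing R K]
    (U : Set R) (hU : IsUnitRepresentatives U)
    (p₁ : R) (p₂ : K) (Q₁ : R[X]) (Q₂ : K[X]) (hred : IsReducedL2 U p₁ p₂ Q₁ Q₂)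
    (F : MvPolynomial (Fin 2) R)
    (hF : MvPolynomial.map (algebraMap R K) F =
      length2Poly (algebraMap R K p₁) p₂ (Q₁.map (algebraMap R K)) Q₂)
    (hcoord : F ∈ VA₂ R) :
    (IsTame F ↔ ∃ σ τ : GA 2 R,
      σ (MvPolynomial.X 0) ∈ B1 R ∧ σ (MvPolynomial.X 1) ∈ B1 R ∧
      τ (MvPolynomial.X 0) ∈ B1 R ∧ τ (MvPolynomial.X 1) ∈ B1 R ∧
      (σ * τ) (MvPolynomial.X 1) = F) ∧
    (HasMateOfLengthOne F ↔ ∃ u : Rˣ, algebraMap R K p₁ * p₂ = algebraMap R K (u : R)) ∧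
    (HasLengthOnePlusOne F ↔
      Q₁.map (Ideal.Quotient.mk (Ideal.span {p₁})) ∈ VA₁ (R ⧸ Ideal.span {p₁})) ∧
    (IsTame F ∨ HasMateOfLengthOne F → HasLengthOnePlusOne F) := by
  have hp₁ : p₁ ≠ 0 := fun h => hred.isL2.p₁_ne_zero (by rw [h, map_zero])
  have hp₂ := hred.isL2.p₂_ne_zero
  have hn := hred.isL2.two_le_degree
  have hQ₁ := hred.Q₁_zero
  have hgcd := hred.gcd_eq_one
  refine ⟨⟨exists_B1_pairs_of_tame hp₁ hp₂ hQ₁ hgcd hn hF, ?_⟩,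
    ⟨mul_eq_unit_of_hasMate hp₁ hp₂ hQ₁ hgcd hn hF, ?_⟩, ⟨fun h => ?_, ?_⟩, ?_⟩
  · rintro ⟨σ, τ, hσx, hσy, hτx, hτy, h⟩
    exact ⟨σ * τ, mul_mem (mem_TA_of_mem_B1 hσx hσy) (mem_TA_of_mem_B1 hτx hτy), h⟩
  · rintro ⟨u, hu⟩
    exact hasMate_of_mul_eq_unit hp₁ hp₂ hF hcoord hu
  · exact mod_mem_VA₁_of_mem_VA₂
      (mem_VA₂_of_hasLengthOnePlusOne hp₁ hQ₁ hred.Q₂_zero hgcd hn hF h)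
  · exact hasLengthOnePlusOne_of_mod hp₁ hp₂ hF hcoord
  · rintro (h | h)
    · obtain ⟨σ, τ, -, hσy, -, hτy, h⟩ := exists_B1_pairs_of_tame hp₁ hp₂ hQ₁ hgcd hn hF h
      exact ⟨σ, τ, hσy, hτy, h⟩
    · obtain ⟨σ, -, hσ⟩ := exists_GA_of_hasMate hp₁ hp₂ hQ₁ hgcd hn hF h
      exact hasLengthOnePlusOne_of_mod hp₁ hp₂ hF hcoord (mod_mem_VA₁_of_mem_VA₂ ⟨σ, hσ⟩)
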